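/- A metric space is \emph{hyperbolic} if it is Gromov hyperbolic, i.e. for some $\delta$ the Gromov products $(y|z)_x=\tfrac12(d(x,y)+d(x,z)-d(y,z))$ satisfy $(y|z)_x\ge\min\{(y|w)_x,(w|z)_x\}-\delta$ for all $x,y,z,w$. Its visual boundary $\partial X$ is the set of classes of sequences $(x_n)$ with $(x_n|x_m)_x\to\infty$, where $(x_n)\sim(y_n)$ if $(x_n|y_n)_x\to\infty$; it carries the topology in which the sets $V_n=\{[(y_i)] : \liminf_i (y_i|x_i)_x\ge n\}$ form a basis of neighbourhoods of $[(x_i)]$. A locally compact group is \emph{hyperbolic} if it has a compact generating set whose word metric is hyperbolic, and \emph{amenable} if it has a left-invariant mean on its bounded continuous functions. Let a group $G$ act by isometries on a nonempty proper hyperbolic geodesic metric space $X$. A point $\xi\in\partial X$ is a \emph{conical limit point} if some tubular neighbourhood of a geodesic ray pointing to $\xi$ meets some $G$-orbit in an unbounded set, and it is \emph{bounded parabolic} if its stabilizer $G_\xi$ acts cocompactly on $\partial X\setminus\{\xi\}$. The action is \emph{geometrically finite} if every point of $\partial X$ is a conical limit point or a non-isolated bounded parabolic point. An element $g\in G$ is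 \emph{hyperbolic} if $\lim_n \frac1n d(x,g^nx)>0$; its \emph{endpoints} are the points of $\partial X$ that are limits of sequences in $\langle g\rangle x$. The action is \emph{of general type} if there are two hyperbolic elements with no common endpoint. A locally compact group is \emph{relatively hyperbolic} if it admits a continuous, metrically proper, geometrically finite isometric action on some nonempty proper hyperbolic geodesic metric space. \textbf{Theorem.} (1) Every amenable locally compact group that is relatively hyperbolic is hyperbolic. (2) Let $X$ be a nonempty proper hyperbolic geodesic metric space, let $\mathrm{Isom}(X)$ carry the compact-open topology, and let $G\le\mathrm{Isom}(X)$ be a closed subgroup whose action on $X$ is geometrically finite. Then $G$ acts cocompactly on $X$ or the action of $G$ on $X$ is of general type. If $G$ acts cocompactly, then $G$ is hyperbolic; if the action is of general type, then $G$ is not amenable. -/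

import Mathlib

open Filter Topology Bornology

universe u v w

namespace HypGrp

/-! ### Gromov hyperbolicity -/

/-- The Gromov product `(y|z)_x = (d(x,y) + d(x,z) - d(y,z)) / 2` for a distance function `d`. -/
noncomputable def gromovProduct {Y : Type*} (d : Y → Y → ℝ) (x y z : Y) : ℝ :=
  (d x y + d x z - d y z) / 2

/-- Gromov hyperbolicity of a distance function: the four point condition
`(y|z)_x ≥ min ((y|w)_x, (w|z)_x) - δ` for some uniform constant `δ`. -/
def IsGromovHyperbolic {Y : Type*} (d : Y → Y → ℝ) : Prop :=
  ∃ δ : ℝ, ∀ x y z w : Y,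
    min (gromovProduct d x y w) (gromovProduct d x w z) - δ ≤ gromovProduct d x y z

/-- A Gromov hyperbolic metric space. -/
class HyperbolicSpace (X : Type*) [MetricSpace X] : Prop where
  hyperbolic : IsGromovHyperbolic (fun x y : X => dist x y)

/-- A geodesic metric space: any two points are joined by an isometrically embedded segment. -/
class GeodesicSpace (X : Type*) [MetricSpace X] : Prop where
  exists_geodesic : ∀ x y : X, ∃ γ : ℝ → X, γ 0 = x ∧ γ (dist x y) = y ∧
    ∀ s ∈ Set.Icc (0 : ℝ) (dist x y), ∀ t ∈ Set.Icc (0 : ℝ) (dist x y),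
      dist (γ s) (γ t) = |s - t|

/-! ### Hyperbolic and amenable groups -/

/-- The word length of `g` with respect to `S`: the least length of a word in `S ∪ S⁻¹` that
represents `g` (such a word exists when `S` generates the group). -/
noncomputable def wordLength {G : Type*} [Group G] (S : Set G) (g : G) : ℕ :=
  sInf {n : ℕ | ∃ l : List G, l.length = n ∧ (∀ s ∈ l, s ∈ S ∨ s⁻¹ ∈ S) ∧ l.prod = g}

/-- The left-invariant word metric `d_S(g, h) = |g⁻¹ h|_S`. -/
noncomputable def wordDist {G : Type*} [Group G] (S : Set G) (g h : G) : ℝ :=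
  (wordLength S (g⁻¹ * h) : ℝ)

/-- A (locally compact) group is hyperbolic if it has a compact generating set whose word metric
is Gromov hyperbolic. -/
def IsHyperbolicGroup (G : Type*) [Group G] [TopologicalSpace G] : Prop :=
  ∃ S : Set G, IsCompact S ∧ Subgroup.closure S = ⊤ ∧ IsGromovHyperbolic (wordDist S)

/-- Left translation of a bounded continuous function: `(leftTranslate g f) h = f (g h)`. -/
def leftTranslate {G : Type*} [Group G] [TopologicalSpace G] [IsTopologicalGroup G]
    (g : G) (f : BoundedContinuousFunction G ℝ) : BoundedContinuousFunction G ℝ :=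
  f.compContinuous ⟨fun h => g * h, continuous_const_mul g⟩

/-- A (locally compact) group is amenable if there is a left-invariant mean on the space of
bounded continuous real functions. -/
def IsAmenable (G : Type*) [Group G] [TopologicalSpace G] [IsTopologicalGroup G] : Prop :=
  ∃ m : BoundedContinuousFunction G ℝ →ₗ[ℝ] ℝ,
    (∀ f : BoundedContinuousFunction G ℝ, (∀ h, 0 ≤ f h) → 0 ≤ m f) ∧
    m 1 = 1 ∧
    ∀ (g : G) (f : BoundedContinuousFunction G ℝ), m (leftTranslate g f) = m f

/-! ### The visual boundary -/

/-- The Gromov product in a metric space. -/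
noncomputable abbrev gp {X : Type*} [MetricSpace X] (x y z : X) : ℝ :=
  gromovProduct (fun a b : X => dist a b) x y z

theorem gp_comm {X : Type*} [MetricSpace X] (x y z : X) : gp x y z = gp x z y := by
  simp only [gp, gromovProduct, dist_comm y z]; ring

/-- Cauchy-Gromov sequences: `(u_n|u_m)_x → ∞` as `n, m → ∞` (for every base point `x`). -/
def CauchyGromovSeq (X : Type*) [MetricSpace X] : Type _ :=
  {u : ℕ → X // ∀ x : X, Tendsto (fun p : ℕ × ℕ => gp x (u p.1) (u p.2)) atTop atTop}

/-- Two Cauchy-Gromov sequences are equivalent if `(u_n|v_n)_x → ∞`. -/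
def boundarySetoid (X : Type*) [MetricSpace X] [HyperbolicSpace X] :
    Setoid (CauchyGromovSeq X) where
  r u v := ∀ x : X, Tendsto (fun n : ℕ => gp x (u.1 n) (v.1 n)) atTop atTop
  iseqv :=
    { refl := fun u x => (u.2 x).comp tendsto_atTop_diagonal
      symm := fun {u v} h x => by simpa only [gp_comm x (v.1 _)] using h x
      trans := fun {u v w} huv hvw x => by
        obtain ⟨δ, hδ⟩ := HyperbolicSpace.hyperbolic (X := X)
        refine tendsto_atTop.2 fun b => ?_
        filter_upwards [tendsto_atTop.1 (huv x) (b + δ), tendsto_atTop.1 (hvw x) (b + δ)]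
          with n h1 h2
        have h3 := hδ x (u.1 n) (w.1 n) (v.1 n)
        have h4 := le_min h1 h2
        linarith }

/-- The visual boundary of a hyperbolic space. -/
def Boundary (X : Type*) [MetricSpace X] [HyperbolicSpace X] : Type _ :=
  Quotient (boundarySetoid X)

/-- The boundary point represented by a Cauchy-Gromov sequence. -/
def Boundary.mk {X : Type*} [MetricSpace X] [HyperbolicSpace X] (u : CauchyGromovSeq X) :
    Boundary X :=
  Quotient.mk (boundarySetoid X) u

/-- The sequence `p` of points of `X` converges to the boundary point `ξ`, i.e. it is a
Cauchy-Gromov sequence that represents `ξ`. -/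
def ConvergesTo {X : Type*} [MetricSpace X] [HyperbolicSpace X] (p : ℕ → X) (ξ : Boundary X) :
    Prop :=
  ∃ u : CauchyGromovSeq X, u.1 = p ∧ Boundary.mk u = ξ

/-- `ξ` and `η` have representatives with `(u_n|v_n)_x ≥ r` for all large `n`. For fixed `x` and
`ξ`, and `r → ∞`, these sets of `η` form a neighbourhood basis of `ξ` in the boundary. -/
def BoundaryClose {X : Type*} [MetricSpace X] [HyperbolicSpace X] (x : X) (r : ℝ)
    (ξ η : Boundary X) : Prop :=
  ∃ p q : ℕ → X, ConvergesTo p ξ ∧ ConvergesTo q η ∧ ∀ᶠ n in atTop, r ≤ gp x (p n) (q n)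

/-- The usual topology of the visual boundary. -/
instance boundaryTopology (X : Type*) [MetricSpace X] [HyperbolicSpace X] :
    TopologicalSpace (Boundary X) where
  IsOpen U := ∀ ξ ∈ U, ∀ x : X, ∃ r : ℝ, ∀ η, BoundaryClose x r ξ η → η ∈ U
  isOpen_univ := fun _ _ _ => ⟨0, fun _ _ => Set.mem_univ _⟩
  isOpen_inter := by
    rintro U V hU hV ξ ⟨hξU, hξV⟩ x
    obtain ⟨r, hr⟩ := hU ξ hξU x
    obtain ⟨s, hs⟩ := hV ξ hξV x
    refine ⟨max r s, fun η ⟨p, q, hp, hq, h⟩ => ⟨hr η ⟨p, q, hp, hq, ?_⟩, hs η ⟨p, q, hp, hq, ?_⟩⟩⟩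
    · exact h.mono fun n hn => (le_max_left r s).trans hn
    · exact h.mono fun n hn => (le_max_right r s).trans hn
  isOpen_sUnion := by
    rintro 𝒰 h𝒰 ξ ⟨U, hU, hξ⟩ x
    obtain ⟨r, hr⟩ := h𝒰 U hU ξ hξ x
    exact ⟨r, fun η hη => ⟨U, hU, hr η hη⟩⟩

section Action

variable {G : Type*} [Group G] {X : Type*} [MetricSpace X] [MulAction G X] [IsIsometricSMul G X]

theorem gp_smul (g : G) (x y z : X) : gp (g • x) (g • y) (g • z) = gp x y z := by
  simp only [gp, gromovProduct, dist_smul]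

theorem gp_smul_right (g : G) (x y z : X) : gp x (g • y) (g • z) = gp (g⁻¹ • x) y z := by
  rw [← gp_smul g (g⁻¹ • x), smul_inv_smul]

/-- The translate of a Cauchy-Gromov sequence by an isometry. -/
def CauchyGromovSeq.translate (g : G) (u : CauchyGromovSeq X) : CauchyGromovSeq X :=
  ⟨fun n => g • u.1 n, fun x => by
    simpa only [gp_smul_right g x] using u.2 (g⁻¹ • x)⟩

/-- The action on the visual boundary that is induced by an isometric action. -/
instance boundaryAction [HyperbolicSpace X] : MulAction G (Boundary X) where
  smul g := Quotient.map' (s₁ := boundarySetoid X) (s₂ := boundarySetoid X)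
    (CauchyGromovSeq.translate g) (fun u v (h : ∀ x, Tendsto _ _ _) x => by
      simpa only [CauchyGromovSeq.translate, gp_smul_right g x] using h (g⁻¹ • x))
  one_smul ξ := by
    refine Quotient.inductionOn ξ fun u => ?_
    exact congrArg (Quotient.mk (boundarySetoid X)) (Subtype.ext (funext fun n => one_smul G _))
  mul_smul g h ξ := by
    refine Quotient.inductionOn ξ fun u => ?_
    exact congrArg (Quotient.mk (boundarySetoid X)) (Subtype.ext (funext fun n => mul_smul g h _))

end Action

/-! ### Isometric actions -/

section ActionTypes

variable (G : Type*) [Group G] (X : Type*) [MetricSpace X] [MulAction G X] [IsIsometricSMul G X]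

/-- A cocompact action: some compact subset has translates that cover the space. -/
def IsCocompactAction : Prop :=
  ∃ K : Set X, IsCompact K ∧ ∀ x : X, ∃ g : G, ∃ k ∈ K, g • k = x

/-- A metrically proper action: the function `g ↦ d(x, g x)` is proper. -/
def IsMetricallyProper [TopologicalSpace G] : Prop :=
  ∀ (x : X) (r : ℝ), IsCompact {g : G | dist x (g • x) ≤ r}

variable {G}

/-- `g` acts as a hyperbolic isometry: `lim d(x, g^n x) / n > 0`. -/
def IsHyperbolicElement (g : G) : Prop :=
  ∃ x : X, ∃ l : ℝ, 0 < l ∧ Tendsto (fun n : ℕ => dist x (g ^ n • x) / n) atTop (𝓝 l)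

variable [HyperbolicSpace X]

/-- The limit set of a subgroup `H`: the boundary points that are limits of sequences `h_n x`. -/
def limitSet (H : Subgroup G) : Set (Boundary X) :=
  {ξ | ∃ (x : X) (h : ℕ → G), (∀ n, h n ∈ H) ∧ ConvergesTo (fun n => h n • x) ξ}

/-- The endpoints of (the cyclic group generated by) `g`. -/
def endpoints (g : G) : Set (Boundary X) :=
  limitSet X (Subgroup.zpowers g)

variable (G)

/-- An action of general type: there are two hyperbolic elements with no common endpoint. -/
def IsGeneralType : Prop :=
  ∃ g h : G, IsHyperbolicElement X g ∧ IsHyperbolicElement X h ∧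
    Disjoint (endpoints X g) (endpoints X h)

variable {X}

/-- `ξ` is a conical limit point: some tubular neighbourhood of a geodesic ray pointing to `ξ`
meets some orbit in an unbounded set. -/
def IsConicalLimitPoint (ξ : Boundary X) : Prop :=
  ∃ γ : NNReal → X, Isometry γ ∧ ConvergesTo (fun n : ℕ => γ n) ξ ∧
    ∃ (r : ℝ) (x : X),
      ¬ IsBounded (MulAction.orbit G x ∩ Metric.thickening r (Set.range γ))

/-- `ξ` is bounded parabolic: its stabilizer acts cocompactly on the complement of `ξ` in the
boundary. -/
def IsBoundedParabolic (ξ : Boundary X) : Prop :=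
  ∃ K : Set (Boundary X), IsCompact K ∧ K ⊆ {ξ}ᶜ ∧
    ∀ η, η ≠ ξ → ∃ g ∈ MulAction.stabilizer G ξ, ∃ κ ∈ K, g • κ = η

variable (X)

/-- A geometrically finite action: every boundary point is a conical limit point or a
non-isolated bounded parabolic point. -/
def IsGeometricallyFinite : Prop :=
  ∀ ξ : Boundary X, IsConicalLimitPoint G ξ ∨ (IsBoundedParabolic G ξ ∧ ¬ IsOpen {ξ})

end ActionTypes

/-- A (locally compact) group is relatively hyperbolic if it admits a proper, geometrically finite,
continuous isometric action on some nonempty proper hyperbolic geodesic metric space. -/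
def IsRelativelyHyperbolic (G : Type u) [Group G] [TopologicalSpace G] : Prop :=
  ∃ (X : Type v) (_ : MetricSpace X) (_ : Nonempty X) (_ : ProperSpace X) (_ : GeodesicSpace X)
    (_ : HyperbolicSpace X) (_ : MulAction G X) (_ : IsIsometricSMul G X),
    ContinuousSMul G X ∧ IsMetricallyProper G X ∧ IsGeometricallyFinite G X

/-! ### The isometry group as a topological group -/

section Isom

variable {X : Type*} [MetricSpace X]

/-- The isometry group carries the compact-open topology. -/
instance isomTopology : TopologicalSpace (X ≃ᵢ X) :=
  TopologicalSpace.induced (fun g => (⟨g, g.continuous⟩ : C(X, X))) ContinuousMap.compactOpen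

/-- The tautological action of the isometry group. -/
instance isomAction : MulAction (X ≃ᵢ X) X where
  smul g x := g x
  one_smul _ := rfl
  mul_smul _ _ _ := rfl

instance isomIsometric : IsIsometricSMul (X ≃ᵢ X) X where
  isometry_smul g := g.isometry

instance isomSubgroupIsometric (G : Subgroup (X ≃ᵢ X)) : IsIsometricSMul G X where
  isometry_smul g := g.1.isometry

theorem continuous_isom_apply (x : X) : Continuous fun g : X ≃ᵢ X => g x :=
  (continuous_eval_const (F := C(X, X)) x).comp
    (continuous_induced_dom (f := fun g : X ≃ᵢ X => (⟨g, g.continuous⟩ : C(X, X))))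

theorem continuous_isom_of_apply {A : Type*} [TopologicalSpace A] {f : A → X ≃ᵢ X}
    (hf : ∀ x, Continuous fun a => f a x) : Continuous f := by
  refine continuous_induced_rng.2 (ContinuousMap.continuous_of_continuous_uncurry _ ?_)
  refine continuous_iff_continuousAt.2 fun ⟨a, x⟩ => ?_
  refine tendsto_iff_dist_tendsto_zero.2 ?_
  have h1 : Tendsto (fun p : A × X => dist p.2 x + dist (f p.1 x) (f a x)) (𝓝 (a, x)) (𝓝 0) := by
    have : Continuous fun p : A × X => dist p.2 x + dist (f p.1 x) (f a x) :=
      (continuous_snd.dist continuous_const).add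
        (((hf x).comp continuous_fst).dist continuous_const)
    simpa using this.tendsto (a, x)
  refine squeeze_zero (fun _ => dist_nonneg) (fun p => ?_) h1
  calc dist (f p.1 p.2) (f a x) ≤ dist (f p.1 p.2) (f p.1 x) + dist (f p.1 x) (f a x) :=
        dist_triangle _ _ _
    _ = _ := by rw [(f p.1).dist_eq]

instance isomTopologicalGroup : IsTopologicalGroup (X ≃ᵢ X) where
  continuous_mul := by
    refine continuous_isom_of_apply fun x => continuous_iff_continuousAt.2 fun ⟨g, h⟩ => ?_
    refine tendsto_iff_dist_tendsto_zero.2 ?_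
    have h1 : Tendsto (fun p : (X ≃ᵢ X) × (X ≃ᵢ X) =>
        dist (p.2 x) (h x) + dist (p.1 (h x)) (g (h x))) (𝓝 (g, h)) (𝓝 0) := by
      have : Continuous fun p : (X ≃ᵢ X) × (X ≃ᵢ X) =>
          dist (p.2 x) (h x) + dist (p.1 (h x)) (g (h x)) :=
        (((continuous_isom_apply x).comp continuous_snd).dist continuous_const).add
          (((continuous_isom_apply (h x)).comp continuous_fst).dist continuous_const)
      simpa using this.tendsto (g, h)
    refine squeeze_zero (fun _ => dist_nonneg) (fun p => ?_) h1
    calc dist (p.1 (p.2 x)) (g (h x))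
        ≤ dist (p.1 (p.2 x)) (p.1 (h x)) + dist (p.1 (h x)) (g (h x)) := dist_triangle _ _ _
      _ = _ := by rw [p.1.dist_eq]
  continuous_inv := by
    refine continuous_isom_of_apply fun x => continuous_iff_continuousAt.2 fun g => ?_
    refine tendsto_iff_dist_tendsto_zero.2 ?_
    have h1 : Tendsto (fun k : X ≃ᵢ X => dist x (k (g⁻¹ x))) (𝓝 g) (𝓝 0) := by
      have : Continuous fun k : X ≃ᵢ X => dist x (k (g⁻¹ x)) :=
        continuous_const.dist (continuous_isom_apply (g⁻¹ x))
      simpa using this.tendsto g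
    refine h1.congr fun k => ?_
    have := k.dist_eq (k⁻¹ x) (g⁻¹ x)
    rw [IsometryEquiv.apply_inv_self] at this
    exact this

end Isom

end HypGrp

open HypGrp

/-! The core is that a geometrically finite action which is not cocompact is of general type.
Non-cocompactness yields a geodesic ray from `x` that leaves the orbit of `x` at unit speed up to an
additive error. Orbit points do not follow this ray, so its endpoint ξ is not conical
(`IsConicalLimitPoint.isRadial`, `FourPoint.not_isRadial_of_ray`) and must be a non-isolated bounded
parabolic point. A bounded parabolic point whose stabilizer has bounded orbits is isolated
(`IsBoundedParabolic.isOpen`), so it remains to find such a stabilizer when the action is not of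
general type.

If some `g` is hyperbolic, every `a` fixing ξ is not, since fixed points of hyperbolic elements are
conical. The elements `g` and `a * g * a⁻¹` share an endpoint, and this bounds the displacement of
`a` (`exists_dist_le_of_not_isGeneralType`). If no element is hyperbolic, far orbit points all lie
in one direction (`FourPoint.gp_smul_smul_ge`). Then no boundary point is conical, so all are
non-isolated bounded parabolic, while some stabilizer has bounded orbits.

An action of general type excludes amenability: the group is covered by two sets, one for each of
two independent hyperbolic elements, and each set meets the orbits of its element's powers a bounded
number of times. A proper cocompact action gives hyperbolicity by the Milnor-Schwarz and Morse
lemmas. -/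

namespace HypGrp

/-! ### Gromov products and the four point condition -/

section GromovProduct

variable {X : Type*} [MetricSpace X]

theorem gp_def (x y z : X) : gp x y z = (dist x y + dist x z - dist y z) / 2 := rfl

theorem gp_nonneg (x y z : X) : 0 ≤ gp x y z := by
  have := dist_triangle_left y z x
  rw [gp_def]; linarith

theorem gp_le_left (x y z : X) : gp x y z ≤ dist x y := by
  have := dist_triangle x y z
  rw [gp_def]; linarith

theorem gp_le_right (x y z : X) : gp x y z ≤ dist x z := by
  rw [gp_comm]; exact gp_le_left x z y

theorem gp_add_gp (x y z : X) : gp x y z + gp y x z = dist x y := by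
  rw [gp_def, gp_def, dist_comm y x]; ring

theorem gp_base_le (x x' y z : X) : gp x y z ≤ gp x' y z + dist x x' := by
  have h1 := dist_triangle x x' y
  have h2 := dist_triangle x x' z
  rw [gp_def, gp_def]; linarith

theorem gp_right_le (x y z z' : X) : gp x y z ≤ gp x y z' + dist z z' := by
  have h1 := dist_triangle_right x z z'
  have h2 := dist_triangle y z z'
  rw [gp_def, gp_def]; linarith

theorem gp_left_le (x y y' z : X) : gp x y z ≤ gp x y' z + dist y y' := by
  rw [gp_comm x y, gp_comm x y']; exact gp_right_le x z y y'

theorem dist_sub_le_gp (x y z : X) : dist x y - dist y z ≤ gp x y z := by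
  have := dist_triangle x z y
  rw [dist_comm z y] at this
  rw [gp_def]; linarith

/-- The four point condition with a nonnegative constant `δ`. -/
def FourPoint (X : Type*) [MetricSpace X] (δ : ℝ) : Prop :=
  0 ≤ δ ∧ ∀ x y z w : X, min (gp x y w) (gp x w z) ≤ gp x y z + δ

theorem exists_fourPoint (X : Type*) [MetricSpace X] [HyperbolicSpace X] :
    ∃ δ, FourPoint X δ := by
  obtain ⟨δ, hδ⟩ := HyperbolicSpace.hyperbolic (X := X)
  refine ⟨max δ 0, le_max_right _ _, fun x y z w => ?_⟩
  have h1 := hδ x y z w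
  have h2 := le_max_left δ 0
  change min (gp x y w) (gp x w z) - δ ≤ gp x y z at h1
  linarith

theorem FourPoint.le_or {δ : ℝ} (h : FourPoint X δ) (x y z w : X) :
    gp x y w ≤ gp x y z + δ ∨ gp x w z ≤ gp x y z + δ := by
  have := h.2 x y z w
  rwa [min_le_iff] at this

theorem FourPoint.ge {δ r : ℝ} (h : FourPoint X δ) {x y z w : X} (h1 : r ≤ gp x y w)
    (h2 : r ≤ gp x w z) : r - δ ≤ gp x y z := by
  have := h.2 x y z w
  have := le_min h1 h2
  linarith

/-- The elementary step from local to global geodesicity. -/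
theorem FourPoint.step {δ a b : ℝ} (h : FourPoint X δ) {x p q r : X} (h1 : gp p x q ≤ a)
    (h2 : gp q p r ≤ b) (hL : a + b + δ < dist p q) : gp q x r ≤ b + δ := by
  have h3 := gp_add_gp p q x
  rw [gp_comm p q x] at h3
  rcases h.le_or q p r x with h4 | h4 <;> linarith

end GromovProduct

/-! ### Hyperbolic isometries -/

section Hyperbolic

variable {G : Type*} [Group G] {X : Type*} [MetricSpace X] [MulAction G X] [IsIsometricSMul G X]

theorem dist_inv_smul_self (g : G) (x : X) : dist x (g⁻¹ • x) = dist x (g • x) := by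
  rw [← dist_smul g x (g⁻¹ • x), smul_inv_smul, dist_comm]

theorem dist_smul_smul_le (g : G) (x y : X) :
    dist x (g • x) ≤ dist y (g • y) + 2 * dist x y := by
  have h1 := dist_triangle4 x y (g • y) (g • x)
  rw [dist_smul, dist_comm y x] at h1
  linarith

theorem gp_smul_left (g : G) (x y z : X) : gp (g • x) y z = gp x (g⁻¹ • y) (g⁻¹ • z) := by
  rw [← gp_smul g x, smul_inv_smul, smul_inv_smul]

theorem isHyperbolicElement_of_linear {g : G} {x : X} {ε : ℝ} (hε : 0 < ε)
    (h : ∀ n : ℕ, ε * n ≤ dist x (g ^ n • x)) : IsHyperbolicElement X g := by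
  have hsub : Subadditive fun n : ℕ => dist x (g ^ n • x) := fun m n => by
    have := dist_triangle x (g ^ m • x) (g ^ (m + n) • x)
    simpa only [pow_add, mul_smul, dist_smul] using this
  have hbdd : BddBelow (Set.range fun n : ℕ => dist x (g ^ n • x) / n) :=
    ⟨0, by rintro _ ⟨n, rfl⟩; positivity⟩
  refine ⟨x, hsub.lim, lt_of_lt_of_le hε ?_, hsub.tendsto_lim hbdd⟩
  refine ge_of_tendsto (hsub.tendsto_lim hbdd) ?_
  filter_upwards [eventually_gt_atTop 0] with n hn
  rw [le_div_iff₀ (by exact_mod_cast hn)]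
  exact h n

/-- Induction with `FourPoint.step` at the vertex `x`: the induction hypothesis, translated by
`g⁻¹`, controls the preceding vertex. The output of the step depends only on the angle at `x`, so
errors do not accumulate. -/
theorem FourPoint.gp_pow_le {δ c : ℝ} (h : FourPoint X δ) {g : G} {x : X}
    (hc : gp x (g⁻¹ • x) (g • x) ≤ c) (hL : 2 * c + 2 * δ < dist x (g • x)) (n : ℕ) :
    gp x ((g⁻¹) ^ n • x) (g • x) ≤ c + δ := by
  have hδ := h.1
  induction n with
  | zero =>
    have := gp_nonneg x (g⁻¹ • x) (g • x)
    simp only [pow_zero, one_smul, gp_def, dist_self]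
    linarith
  | succ n ih =>
    refine h.step (p := g⁻¹ • x) (a := c + δ) ?_ hc ?_
    · rw [gp_smul_left, inv_inv, pow_succ', mul_smul, smul_inv_smul]
      exact ih
    · rw [dist_comm, dist_inv_smul_self]; linarith

/-- By `FourPoint.gp_pow_le` each further power of `g` increases the displacement by a fixed
positive amount. -/
theorem FourPoint.isHyperbolicElement {δ : ℝ} (h : FourPoint X δ) {g : G} {x : X}
    (hL : 2 * gp x (g⁻¹ • x) (g • x) + 2 * δ < dist x (g • x)) : IsHyperbolicElement X g := by
  set c := gp x (g⁻¹ • x) (g • x) with hc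
  refine isHyperbolicElement_of_linear (x := x) (sub_pos.2 hL) fun n => ?_
  induction n with
  | zero => simp
  | succ n ih =>
    have h1 := h.gp_pow_le hc.ge hL n
    have h2 : dist x ((g⁻¹) ^ n • x) = dist x (g ^ n • x) := by
      rw [inv_pow, dist_inv_smul_self]
    have h3 : dist ((g⁻¹) ^ n • x) (g • x) = dist x (g ^ (n + 1) • x) := by
      rw [← dist_smul (g ^ n), inv_pow, smul_inv_smul, pow_succ, mul_smul]
    rw [gp_def, h2, h3] at h1
    push_cast
    linarith

theorem FourPoint.gp_inv_ge {δ : ℝ} (h : FourPoint X δ) {g : G} (hg : ¬ IsHyperbolicElement X g)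
    (x : X) : dist x (g • x) / 2 - δ ≤ gp x (g⁻¹ • x) (g • x) := by
  by_contra hlt
  exact hg (h.isHyperbolicElement (x := x) (by linarith))

theorem IsHyperbolicElement.tendsto {g : G} (hg : IsHyperbolicElement X g) (x : X) :
    ∃ l : ℝ, 0 < l ∧ Tendsto (fun n : ℕ => dist x (g ^ n • x) / n) atTop (𝓝 l) := by
  obtain ⟨y, l, hl, ht⟩ := hg
  refine ⟨l, hl, ?_⟩
  have h0 : Tendsto (fun n : ℕ => 2 * dist x y / (n : ℝ)) atTop (𝓝 0) :=
    tendsto_const_div_atTop_nhds_zero_nat _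
  have h1 := ht.sub h0
  have h2 := ht.add h0
  rw [sub_zero] at h1
  rw [add_zero] at h2
  refine tendsto_of_tendsto_of_tendsto_of_le_of_le h1 h2 (fun n => ?_) fun n => ?_
  · have := dist_smul_smul_le (g ^ n) y x
    rw [dist_comm y x] at this
    simp only [← sub_div]
    gcongr
    linarith
  · have := dist_smul_smul_le (g ^ n) x y
    simp only [← add_div]
    gcongr

theorem IsHyperbolicElement.tendsto_dist {g : G} (hg : IsHyperbolicElement X g) (x : X) :
    Tendsto (fun n : ℕ => dist x (g ^ n • x)) atTop atTop := by
  obtain ⟨l, hl, ht⟩ := hg.tendsto x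
  have := ht.pos_mul_atTop hl (tendsto_natCast_atTop_atTop (R := ℝ))
  refine this.congr' ?_
  filter_upwards [eventually_gt_atTop 0] with n hn
  have : (n : ℝ) ≠ 0 := by positivity
  field_simp

/-- Otherwise the displacement of `g ^ (2 ^ j)` would grow at most linearly in `j`, contradicting a
positive translation length. -/
theorem IsHyperbolicElement.exists_doubling {g : G} (hg : IsHyperbolicElement X g) (x : X)
    (A : ℝ) : ∃ k : ℕ, 0 < k ∧ dist x (g ^ k • x) + A ≤ dist x (g ^ (2 * k) • x) := by
  by_contra! hcon
  obtain ⟨l, hl, ht⟩ := hg.tendsto x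
  have h1 : ∀ j : ℕ, dist x (g ^ (2 ^ j) • x) ≤ dist x (g • x) + j * A := by
    intro j
    induction j with
    | zero => simp
    | succ j ih =>
      have := hcon (2 ^ j) (by positivity)
      rw [pow_succ']
      push_cast
      linarith
  have h2 : Tendsto (fun j : ℕ => dist x (g ^ (2 ^ j) • x) / ((2 ^ j : ℕ) : ℝ)) atTop (𝓝 l) :=
    ht.comp (tendsto_pow_atTop_atTop_of_one_lt one_lt_two)
  have h3 : Tendsto (fun j : ℕ => (dist x (g • x) + j * A) / ((2 ^ j : ℕ) : ℝ)) atTop (𝓝 0) := by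
    have e1 : Tendsto (fun j : ℕ => ((1 / 2 : ℝ)) ^ j) atTop (𝓝 0) :=
      tendsto_pow_atTop_nhds_zero_of_lt_one (by norm_num) (by norm_num)
    have e2 : Tendsto (fun j : ℕ => (j : ℝ) * ((1 / 2 : ℝ)) ^ j) atTop (𝓝 0) :=
      tendsto_self_mul_const_pow_of_lt_one (by norm_num) (by norm_num)
    have e3 := (e1.const_mul (dist x (g • x))).add (e2.const_mul A)
    simp only [mul_zero, add_zero] at e3
    refine e3.congr fun j => ?_
    push_cast
    rw [one_div, inv_pow]
    field_simp
  have h4 := le_of_tendsto_of_tendsto' h2 h3 fun j => by gcongr; exact h1 j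
  linarith

theorem dist_pow_smul_le (g : G) (x : X) (n : ℕ) : dist x (g ^ n • x) ≤ n * dist x (g • x) := by
  induction n with
  | zero => simp
  | succ n ih =>
    have := dist_triangle x (g ^ n • x) (g ^ (n + 1) • x)
    rw [pow_succ, mul_smul, dist_smul] at this
    rw [pow_succ, mul_smul]
    push_cast
    linarith

/-- The orbits of a hyperbolic element are quasi-geodesics. -/
theorem FourPoint.exists_gp_pow_le {δ : ℝ} (h : FourPoint X δ) {g : G}
    (hg : IsHyperbolicElement X g) (x : X) :
    ∃ C : ℝ, ∀ m n : ℕ, gp x ((g⁻¹) ^ m • x) (g ^ n • x) ≤ C := by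
  have hδ := h.1
  -- The gain `3 * δ + 1` makes the Gromov product `c` at `x` of the orbit of `f = g ^ k` so small
  -- that the local-to-global argument applies to `f`.
  obtain ⟨k, hk, hA⟩ := hg.exists_doubling x (3 * δ + 1)
  set f := g ^ k with hf
  set c := gp x (f⁻¹ • x) (f • x) with hc
  have hcv : 2 * c + 3 * δ + 1 ≤ dist x (f • x) := by
    have e1 : dist (f⁻¹ • x) (f • x) = dist x (g ^ (2 * k) • x) := by
      rw [← dist_smul f, smul_inv_smul, ← mul_smul, hf, ← pow_add, two_mul]
    have e2 := gp_def x (f⁻¹ • x) (f • x)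
    rw [dist_inv_smul_self, e1, ← hc] at e2
    linarith
  have h1 := h.gp_pow_le hc.ge (by linarith)
  have h2 : ∀ n : ℕ, gp x (f ^ n • x) (f⁻¹ • x) ≤ c + δ := by
    intro n
    have := h.gp_pow_le (g := f⁻¹) (x := x) (c := c) (by rw [inv_inv, gp_comm])
      (by rw [dist_inv_smul_self]; linarith) n
    rwa [inv_inv] at this
  have h3 : ∀ m n : ℕ, gp x ((f⁻¹) ^ m • x) (f ^ n • x) ≤ c + 2 * δ := by
    intro m n
    cases n with
    | zero =>
      have := gp_nonneg x (f⁻¹ • x) (f • x)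
      simp only [pow_zero, one_smul]
      have := gp_le_right x ((f⁻¹) ^ m • x) x
      rw [dist_self] at this
      linarith
    | succ n =>
      have e1 := gp_add_gp x (f • x) (f ^ (n + 1) • x)
      rw [gp_smul_left, pow_succ', mul_smul, inv_smul_smul, gp_comm x (f⁻¹ • x)] at e1
      rw [pow_succ', mul_smul]
      have e2 := h2 n
      rcases h.le_or x ((f⁻¹) ^ m • x) (f • x) (f • f ^ n • x) with e3 | e3
      · have := h1 m
        linarith
      · have := h1 m
        rw [gp_comm] at e3
        linarith
  refine ⟨c + 2 * δ + 2 * (k * dist x (g • x)), fun m n => ?_⟩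
  -- Replacing a power of `a` by a power of `a ^ k` leaves a remainder of fewer than `k` steps.
  have key : ∀ (a : G) (m : ℕ), dist x (a • x) = dist x (g • x) →
      dist ((a ^ m) • x) ((a ^ k) ^ (m / k) • x) ≤ k * dist x (g • x) := by
    intro a m ha
    have : a ^ m = (a ^ k) ^ (m / k) * a ^ (m % k) := by
      rw [← pow_mul, ← pow_add, Nat.div_add_mod]
    rw [this, mul_smul, dist_smul, dist_comm, ← ha]
    refine (dist_pow_smul_le a x _).trans ?_
    have := (Nat.mod_lt m hk).le
    gcongr
  have e1 := key g⁻¹ m (dist_inv_smul_self g x)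
  have e2 := key g n rfl
  rw [inv_pow g k, ← hf] at e1
  rw [← hf] at e2
  have e3 := gp_left_le x ((g⁻¹) ^ m • x) ((f⁻¹) ^ (m / k) • x) (g ^ n • x)
  have e4 := gp_right_le x ((f⁻¹) ^ (m / k) • x) (g ^ n • x) (f ^ (n / k) • x)
  have e5 := h3 (m / k) (n / k)
  linarith

theorem IsHyperbolicElement.inv {g : G} (hg : IsHyperbolicElement X g) :
    IsHyperbolicElement X g⁻¹ := by
  obtain ⟨x, l, hl, ht⟩ := hg
  exact ⟨x, l, hl, ht.congr fun n => by rw [inv_pow, dist_inv_smul_self]⟩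

theorem IsHyperbolicElement.conj {g : G} (hg : IsHyperbolicElement X g) (a : G) :
    IsHyperbolicElement X (a * g * a⁻¹) := by
  obtain ⟨x, l, hl, ht⟩ := hg
  refine ⟨a • x, l, hl, ht.congr fun n => ?_⟩
  rw [conj_pow, mul_smul, mul_smul, inv_smul_smul, dist_smul]

/-- Points of a forward orbit of a hyperbolic element have large Gromov products. -/
theorem FourPoint.exists_gp_pow_pow_ge {δ : ℝ} (h : FourPoint X δ) {g : G}
    (hg : IsHyperbolicElement X g) (x : X) :
    ∃ C : ℝ, ∀ m n : ℕ, m ≤ n → dist x (g ^ m • x) - C ≤ gp x (g ^ m • x) (g ^ n • x) := by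
  obtain ⟨C, hC⟩ := h.exists_gp_pow_le hg x
  refine ⟨C, fun m n hmn => ?_⟩
  have h1 := gp_add_gp x (g ^ m • x) (g ^ n • x)
  obtain ⟨k, rfl⟩ := Nat.exists_eq_add_of_le hmn
  have h2 := hC m k
  rw [inv_pow] at h2
  rw [gp_smul_left (g ^ m) x, pow_add, mul_smul, inv_smul_smul] at h1
  rw [pow_add, mul_smul]
  linarith

/-- Without hyperbolic elements, orbit points far away have large Gromov products. -/
theorem FourPoint.gp_smul_smul_ge {δ : ℝ} (h : FourPoint X δ)
    (hG : ∀ g : G, ¬ IsHyperbolicElement X g) (x : X) (g k : G) :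
    min (dist x (g • x)) (dist x (k • x)) / 2 - 5 * δ ≤ gp x (g • x) (k • x) := by
  have hδ := h.1
  by_contra! hlt
  set c := gp x (g • x) (k • x) with hc
  have hg : 2 * c + 10 * δ < dist x (g • x) := by
    have := min_le_left (dist x (g • x)) (dist x (k • x)); linarith
  have hk : 2 * c + 10 * δ < dist x (k • x) := by
    have := min_le_right (dist x (g • x)) (dist x (k • x)); linarith
  have hg' := h.gp_inv_ge (hG g) x
  have hk' := h.gp_inv_ge (hG k) x
  -- As `g` and `k` are not hyperbolic, `g⁻¹ • x` and `k⁻¹ • x` lie in the directions of `g • x` and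
  -- `k • x`, which are assumed to diverge.
  have e1 : gp x (g⁻¹ • x) (k • x) ≤ c + δ := by
    rcases h.le_or x (g • x) (k • x) (g⁻¹ • x) with e | e
    · rw [gp_comm] at e; linarith
    · exact e
  have e2 : gp x (g⁻¹ • x) (k⁻¹ • x) ≤ c + 2 * δ := by
    rcases h.le_or x (g⁻¹ • x) (k • x) (k⁻¹ • x) with e | e <;> linarith
  -- With `f = g⁻¹ * k`, the broken path through `x`, `g⁻¹ • x`, `f • x`, `f • g⁻¹ • x`, `f • f • x`
  -- has long edges and small Gromov products at the inner vertices. So the displacement of `f ^ 2`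
  -- is too large for `f` not to be hyperbolic.
  have s1 : gp (g⁻¹ • x) x ((g⁻¹ * k) • x) = c := by
    rw [gp_smul_left, inv_inv, ← mul_smul, mul_inv_cancel_left]
  have s2 : gp ((g⁻¹ * k) • x) (g⁻¹ • x) ((g⁻¹ * k * g⁻¹) • x) ≤ c + 2 * δ := by
    rw [gp_smul_left, ← mul_smul, ← mul_smul]
    simpa [mul_assoc, gp_comm] using e2
  have s3 : gp ((g⁻¹ * k * g⁻¹) • x) ((g⁻¹ * k) • x) ((g⁻¹ * k * g⁻¹ * k) • x) = c := by
    rw [gp_smul_left, ← mul_smul, ← mul_smul, hc]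
    simp [mul_assoc]
  have d1 : dist x (g⁻¹ • x) = dist x (g • x) := dist_inv_smul_self g x
  have d2 : dist (g⁻¹ • x) ((g⁻¹ * k) • x) = dist x (k • x) := by rw [mul_smul, dist_smul]
  have d3 : dist ((g⁻¹ * k) • x) ((g⁻¹ * k * g⁻¹) • x) = dist x (g • x) := by
    rw [mul_smul _ g⁻¹, dist_smul, d1]
  have d4 : dist ((g⁻¹ * k * g⁻¹) • x) ((g⁻¹ * k * g⁻¹ * k) • x) = dist x (k • x) := by
    rw [mul_smul _ k, dist_smul]
  have c0 : 0 ≤ c := gp_nonneg _ _ _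
  have t2 := h.step (x := x) s1.le s2 (by rw [d2]; linarith)
  have t3 := h.step (x := x) t2 s3.le (by rw [d3]; linarith)
  have w := h.gp_inv_ge (hG (g⁻¹ * k)) x
  have w2 : dist ((g⁻¹ * k)⁻¹ • x) ((g⁻¹ * k) • x) = dist x ((g⁻¹ * k * g⁻¹ * k) • x) := by
    rw [← dist_smul (g⁻¹ * k), smul_inv_smul, ← mul_smul, mul_assoc (g⁻¹ * k)]
  rw [gp_def, dist_inv_smul_self, w2] at w
  rw [gp_def, dist_comm (g⁻¹ • x) x, d1, d2] at s1
  rw [gp_def, dist_comm _ x, d3] at t2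
  rw [gp_def, dist_comm _ x, d4] at t3
  linarith

end Hyperbolic

/-! ### Independent hyperbolic elements and cutoff functions along their orbits -/

section Convergence

variable {X : Type*} [MetricSpace X]

theorem tendsto_gp_base {α : Type*} {l : Filter α} {p q : α → X} {x : X}
    (h : Tendsto (fun a => gp x (p a) (q a)) l atTop) (y : X) :
    Tendsto (fun a => gp y (p a) (q a)) l atTop := by
  refine tendsto_atTop_mono (fun a => ?_) (tendsto_atTop_add_const_right _ (-dist x y) h)
  have := gp_base_le x y (p a) (q a)
  linarith

variable {G : Type*} [Group G] [MulAction G X]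

theorem endpoints_inv [HyperbolicSpace X] (g : G) : endpoints X g⁻¹ = endpoints X g := by
  rw [endpoints, endpoints, Subgroup.zpowers_inv]

/-- The supremum of the Gromov products `(y|g^n x)_x`, for `n` an integer. -/
noncomputable def axisProduct (x : X) (g : G) (y : X) : ℝ :=
  ⨆ n : ℤ, gp x y (g ^ n • x)

theorem gp_le_axisProduct (x : X) (g : G) (y : X) (n : ℤ) :
    gp x y (g ^ n • x) ≤ axisProduct x g y :=
  le_ciSup (f := fun n : ℤ => gp x y (g ^ n • x))
    ⟨dist x y, by rintro _ ⟨n, rfl⟩; exact gp_le_left _ _ _⟩ n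

theorem continuous_axisProduct (x : X) (g : G) : Continuous (axisProduct x g) := by
  refine (LipschitzWith.of_le_add fun y z => ?_).continuous
  change ⨆ n : ℤ, gp x y (g ^ n • x) ≤ axisProduct x g z + dist y z
  refine ciSup_le fun n => ?_
  have h1 := gp_left_le x y z (g ^ n • x)
  have h2 := gp_le_axisProduct x g z n
  linarith

/-- A cutoff function which is `1` at the points whose projection to the orbit of `x` under the
powers of `g` is close to `x`. -/
noncomputable def axisCutoff (x : X) (g : G) (T : ℝ) (y : X) : ℝ :=
  max 0 (min 1 (T + 1 - axisProduct x g y))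

theorem axisCutoff_le_one (x : X) (g : G) (T : ℝ) (y : X) : axisCutoff x g T y ≤ 1 :=
  max_le zero_le_one (min_le_left _ _)

theorem axisCutoff_nonneg (x : X) (g : G) (T : ℝ) (y : X) : 0 ≤ axisCutoff x g T y :=
  le_max_left _ _

theorem axisCutoff_eq_one {x : X} {g : G} {T : ℝ} {y : X} (h : axisProduct x g y ≤ T) :
    axisCutoff x g T y = 1 := by
  rw [axisCutoff, min_eq_left (by linarith), max_eq_right zero_le_one]

variable [IsIsometricSMul G X]

theorem FourPoint.tendsto_gp_pow {δ : ℝ} (h : FourPoint X δ) {g : G}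
    (hg : IsHyperbolicElement X g) (x y : X) :
    Tendsto (fun p : ℕ × ℕ => gp y (g ^ p.1 • x) (g ^ p.2 • x)) atTop atTop := by
  refine tendsto_gp_base (x := x) ?_ y
  obtain ⟨C, hC⟩ := h.exists_gp_pow_pow_ge hg x
  have ht := hg.tendsto_dist x
  refine tendsto_atTop.2 fun r => ?_
  obtain ⟨N, hN⟩ := eventually_atTop.1 (tendsto_atTop.1 ht (r + C))
  filter_upwards [eventually_ge_atTop (N, N)] with p hp
  rcases le_total p.1 p.2 with hle | hle
  · have := hC _ _ hle
    have := hN _ hp.1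
    linarith
  · have := hC _ _ hle
    have := hN _ hp.2
    rw [gp_comm]
    linarith

/-- If the products were unbounded, the two forward orbits would converge to the same boundary
point, a common endpoint. -/
theorem exists_gp_pow_pow_le [HyperbolicSpace X] {g k : G} (hg : IsHyperbolicElement X g)
    (hk : IsHyperbolicElement X k) (hd : Disjoint (endpoints X g) (endpoints X k)) (x : X) :
    ∃ B : ℝ, ∀ m n : ℕ, gp x (g ^ m • x) (k ^ n • x) ≤ B := by
  obtain ⟨δ, h⟩ := exists_fourPoint X
  have hδ := h.1
  by_contra! hcon
  obtain ⟨C, hC⟩ := h.exists_gp_pow_pow_ge hg x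
  obtain ⟨D, hD⟩ := h.exists_gp_pow_pow_ge hk x
  let u : CauchyGromovSeq X := ⟨fun n => g ^ n • x, h.tendsto_gp_pow hg x⟩
  let v : CauchyGromovSeq X := ⟨fun n => k ^ n • x, h.tendsto_gp_pow hk x⟩
  have huv : Boundary.mk u = Boundary.mk v := by
    refine Quotient.sound fun y => tendsto_gp_base (x := x) (tendsto_atTop.2 fun r => ?_) y
    -- The second entry of the maximum forces `g ^ m • x` and `k ^ n • x` to be far from `x`, so
    -- that they are close to all later points of their orbits.
    obtain ⟨m, n, hmn⟩ := hcon (max (r + 2 * δ) (r + 2 * δ + max C D))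
    have h1 := gp_le_left x (g ^ m • x) (k ^ n • x)
    have h2 := gp_le_right x (g ^ m • x) (k ^ n • x)
    have m1 := le_max_left (r + 2 * δ) (r + 2 * δ + max C D)
    have m2 := le_max_right (r + 2 * δ) (r + 2 * δ + max C D)
    have m3 := le_max_left C D
    have m4 := le_max_right C D
    have key : ∀ (a : G) (E : ℝ), (∀ m n : ℕ, m ≤ n →
        dist x (a ^ m • x) - E ≤ gp x (a ^ m • x) (a ^ n • x)) → ∀ i j : ℕ,
        r + 2 * δ + E ≤ dist x (a ^ i • x) → r + 2 * δ + E ≤ dist x (a ^ j • x) →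
        r + 2 * δ ≤ gp x (a ^ i • x) (a ^ j • x) := by
      intro a E hE i j hi hj
      rcases le_total i j with hij | hij
      · have := hE i j hij; linarith
      · have := hE j i hij; rw [gp_comm]; linarith
    filter_upwards [tendsto_atTop.1 (hg.tendsto_dist x) (r + 2 * δ + C),
      tendsto_atTop.1 (hk.tendsto_dist x) (r + 2 * δ + D)] with i hi hi'
    have k1 := key g C hC i m hi (by linarith)
    have k2 := key k D hD n i (by linarith) hi'
    have k3 : r + 2 * δ ≤ gp x (g ^ m • x) (k ^ n • x) := by linarith
    have k4 := h.ge k3 k2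
    have k5 := h.ge (r := r + δ) (show r + δ ≤ gp x (g ^ i • x) (g ^ m • x) by linarith)
      (by linarith : r + δ ≤ gp x (g ^ m • x) (k ^ i • x))
    change r ≤ gp x (g ^ i • x) (k ^ i • x)
    linarith
  refine Set.disjoint_left.1 hd (show Boundary.mk u ∈ endpoints X g from ?_) ?_
  · exact ⟨x, fun n => g ^ n, fun n => Subgroup.npow_mem_zpowers g n, u, rfl, rfl⟩
  · exact ⟨x, fun n => k ^ n, fun n => Subgroup.npow_mem_zpowers k n, v, rfl, huv.symm⟩

theorem exists_gp_zpow_zpow_le [HyperbolicSpace X] {g k : G} (hg : IsHyperbolicElement X g)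
    (hk : IsHyperbolicElement X k) (hd : Disjoint (endpoints X g) (endpoints X k)) (x : X) :
    ∃ B : ℝ, ∀ m n : ℤ, gp x (g ^ m • x) (k ^ n • x) ≤ B := by
  obtain ⟨B₁, h₁⟩ := exists_gp_pow_pow_le hg hk hd x
  obtain ⟨B₂, h₂⟩ := exists_gp_pow_pow_le hg.inv hk (by rwa [endpoints_inv]) x
  obtain ⟨B₃, h₃⟩ := exists_gp_pow_pow_le hg hk.inv (by rwa [endpoints_inv]) x
  obtain ⟨B₄, h₄⟩ := exists_gp_pow_pow_le hg.inv hk.inv (by rwa [endpoints_inv, endpoints_inv]) x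
  refine ⟨max (max B₁ B₂) (max B₃ B₄), fun m n => ?_⟩
  obtain ⟨m, rfl | rfl⟩ := m.eq_nat_or_neg <;> obtain ⟨n, rfl | rfl⟩ := n.eq_nat_or_neg <;>
    simp only [zpow_neg, zpow_natCast, ← inv_pow]
  · exact le_max_of_le_left (le_max_of_le_left (h₁ m n))
  · exact le_max_of_le_right (le_max_of_le_left (h₃ m n))
  · exact le_max_of_le_left (le_max_of_le_right (h₂ m n))
  · exact le_max_of_le_right (le_max_of_le_right (h₄ m n))

/-- The products `(y|g⁻ᵈx)_x` and `(gᵈy|gᵈx)_x = (y|x)_{g⁻ᵈx}` add up to the distance from `x` to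
`gᵈx`, and both are less than `T + 1`. -/
theorem dist_le_of_axisCutoff_pos {x : X} {g : G} {T : ℝ} {y : X} {d : ℕ}
    (h1 : 0 < axisCutoff x g T y) (h2 : 0 < axisCutoff x g T (g ^ d • y)) :
    dist x (g ^ d • x) ≤ 2 * T + 2 := by
  have key : ∀ z : X, 0 < axisCutoff x g T z → axisProduct x g z < T + 1 := by
    intro z hz
    simp only [axisCutoff, lt_max_iff, lt_irrefl, false_or, lt_min_iff] at hz
    linarith
  have e1 := (gp_le_axisProduct x g y (-d)).trans_lt (key _ h1)
  have e2 := (gp_le_axisProduct x g (g ^ d • y) d).trans_lt (key _ h2)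
  have e3 := gp_add_gp x ((g ^ d)⁻¹ • x) y
  rw [zpow_neg, zpow_natCast, gp_comm] at e1
  rw [zpow_natCast, gp_smul_right, gp_comm] at e2
  rw [dist_inv_smul_self] at e3
  linarith

/-- By the preceding lemma, the indices with a nonzero summand lie in a window of bounded length. -/
theorem exists_sum_axisCutoff_le {g : G} (hg : IsHyperbolicElement X g) (x : X) (T : ℝ) :
    ∃ N : ℕ, ∀ (K : ℕ) (y : X), ∑ j ∈ Finset.range K, axisCutoff x g T (g ^ j • y) ≤ N := by
  obtain ⟨N, hN⟩ := eventually_atTop.1 ((hg.tendsto_dist x).eventually_gt_atTop (2 * T + 2))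
  refine ⟨N, fun K y => ?_⟩
  classical
  set s := (Finset.range K).filter fun j => 0 < axisCutoff x g T (g ^ j • y) with hs
  have h1 : ∑ j ∈ Finset.range K, axisCutoff x g T (g ^ j • y)
      = ∑ j ∈ s, axisCutoff x g T (g ^ j • y) := by
    rw [hs, Finset.sum_filter]
    refine Finset.sum_congr rfl fun j _ => ?_
    split_ifs with h
    · rfl
    · exact le_antisymm (not_lt.1 h) (axisCutoff_nonneg _ _ _ _)
  have h2 : s.card ≤ N := by
    rcases s.eq_empty_or_nonempty with h | h
    · simp [h]
    · refine (Finset.card_le_card (t := Finset.Ico (s.min' h) (s.min' h + N)) fun j hj => ?_).trans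
        (by simp)
      have hmin := s.min'_le j hj
      refine Finset.mem_Ico.2 ⟨hmin, ?_⟩
      by_contra! hlt
      have p1 := (Finset.mem_filter.1 (s.min'_mem h)).2
      have p2 := (Finset.mem_filter.1 hj).2
      obtain ⟨d, hd⟩ := Nat.exists_eq_add_of_le' hmin
      rw [hd, pow_add, mul_smul] at p2
      exact absurd (dist_le_of_axisCutoff_pos p1 p2) (not_le.2 (hN d (by omega)))
  rw [h1]
  calc ∑ j ∈ s, axisCutoff x g T (g ^ j • y) ≤ ∑ _j ∈ s, (1 : ℝ) :=
        Finset.sum_le_sum fun j _ => axisCutoff_le_one _ _ _ _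
    _ ≤ N := by simpa using h2

end Convergence

/-! ### Actions of general type and amenability -/

section Amenable

variable {G : Type*} [Group G] [TopologicalSpace G] [IsTopologicalGroup G]

/-- The mean of a sum of `K` translates is `K` times the mean of `f`, yet it is bounded by `M` for
every `K`. -/
theorem mean_nonpos_of_sum_le {m : BoundedContinuousFunction G ℝ →ₗ[ℝ] ℝ}
    (hpos : ∀ f : BoundedContinuousFunction G ℝ, (∀ h, 0 ≤ f h) → 0 ≤ m f) (h1 : m 1 = 1)
    (hinv : ∀ (g : G) (f : BoundedContinuousFunction G ℝ), m (leftTranslate g f) = m f)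
    {f : BoundedContinuousFunction G ℝ} {g : G} {M : ℝ}
    (hf : ∀ (K : ℕ) (k : G), ∑ j ∈ Finset.range K, f (g ^ j * k) ≤ M) : m f ≤ 0 := by
  have key : ∀ K : ℕ, K * m f ≤ M := by
    intro K
    have := hpos (M • 1 - ∑ j ∈ Finset.range K, leftTranslate (g ^ j) f) fun k => by
      have := hf K k
      simp only [BoundedContinuousFunction.coe_sub, BoundedContinuousFunction.coe_smul,
        BoundedContinuousFunction.coe_sum, Pi.sub_apply, BoundedContinuousFunction.coe_one,
        Finset.sum_apply, Pi.one_apply, smul_eq_mul, mul_one, sub_nonneg]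
      exact this
    rw [map_sub, map_smul, map_sum, h1] at this
    simp only [hinv, Finset.sum_const, Finset.card_range, nsmul_eq_mul, smul_eq_mul,
      mul_one] at this
    linarith
  by_contra! hlt
  obtain ⟨K, hK⟩ := exists_nat_gt (M / m f)
  rw [div_lt_iff₀ hlt] at hK
  exact absurd (key K) (not_le.2 hK)

theorem not_isAmenable_of_isGeneralType {X : Type*} [MetricSpace X] [MulAction G X]
    [IsIsometricSMul G X] [HyperbolicSpace X] (hc : ∀ x : X, Continuous fun g : G => g • x)
    (hG : IsGeneralType G X) : ¬ IsAmenable G := by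
  rintro ⟨m, hpos, h1, hinv⟩
  obtain ⟨g, k, hg, hk, hd⟩ := hG
  obtain ⟨x, -⟩ := id hg
  obtain ⟨δ, h⟩ := exists_fourPoint X
  obtain ⟨B, hB⟩ := exists_gp_zpow_zpow_le hg hk hd x
  -- If both axis products exceeded `T`, the four point condition would give orbit points of `g` and
  -- `k` with product at least `T - δ > B`. So one of the two cutoffs equals `1` everywhere on the
  -- orbit, although both have nonpositive mean.
  set T := B + δ + 1 with hT
  let F : G → BoundedContinuousFunction G ℝ := fun a =>
    BoundedContinuousFunction.ofNormedAddCommGroup (fun b : G => axisCutoff x a T (b • x))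
      (continuous_const.max (continuous_const.min (continuous_const.sub
        ((continuous_axisProduct x a).comp (hc x))))) 1 fun b => by
      rw [Real.norm_eq_abs, abs_of_nonneg (axisCutoff_nonneg _ _ _ _)]
      exact axisCutoff_le_one _ _ _ _
  have hF : ∀ a b : G, F a b = axisCutoff x a T (b • x) := fun _ _ => rfl
  have key : ∀ a : G, IsHyperbolicElement X a → m (F a) ≤ 0 := by
    intro a ha
    obtain ⟨N, hN⟩ := exists_sum_axisCutoff_le ha x T
    refine mean_nonpos_of_sum_le hpos h1 hinv (g := a) (M := N) fun K b => ?_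
    simpa only [hF, mul_smul] using hN K (b • x)
  have hsum : 0 ≤ m (F g + F k - 1) := by
    refine hpos _ fun b => ?_
    change 0 ≤ axisCutoff x g T (b • x) + axisCutoff x k T (b • x) - 1
    have n1 := axisCutoff_nonneg x g T (b • x)
    have n2 := axisCutoff_nonneg x k T (b • x)
    by_cases c1 : axisProduct x g (b • x) ≤ T
    · rw [axisCutoff_eq_one c1]; linarith
    by_cases c2 : axisProduct x k (b • x) ≤ T
    · rw [axisCutoff_eq_one c2]; linarith
    exfalso
    obtain ⟨i, hi⟩ := exists_lt_of_lt_ciSup (not_le.1 c1)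
    obtain ⟨j, hj⟩ := exists_lt_of_lt_ciSup (not_le.1 c2)
    rw [gp_comm] at hi
    have := h.ge hi.le hj.le
    have := hB i j
    linarith
  rw [map_sub, map_add, h1] at hsum
  have := key g hg
  have := key k hk
  linarith

end Amenable

/-! ### The Morse lemma for discrete quasi-geodesics -/

section Morse

variable {X : Type*} [MetricSpace X]

/-- `γ` restricts to a geodesic segment from `x` to `y`, parametrized by arc length. -/
def IsGeodesicSegment (γ : ℝ → X) (x y : X) : Prop :=
  γ 0 = x ∧ γ (dist x y) = y ∧
    ∀ s ∈ Set.Icc (0 : ℝ) (dist x y), ∀ t ∈ Set.Icc (0 : ℝ) (dist x y),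
      dist (γ s) (γ t) = |s - t|

theorem IsGeodesicSegment.dist_left {γ : ℝ → X} {x y : X} (h : IsGeodesicSegment γ x y) {t : ℝ}
    (ht : t ∈ Set.Icc (0 : ℝ) (dist x y)) : dist x (γ t) = t := by
  have := h.2.2 0 ⟨le_rfl, dist_nonneg⟩ t ht
  rwa [h.1, zero_sub, abs_neg, abs_of_nonneg ht.1] at this

theorem IsGeodesicSegment.dist_right {γ : ℝ → X} {x y : X} (h : IsGeodesicSegment γ x y) {t : ℝ}
    (ht : t ∈ Set.Icc (0 : ℝ) (dist x y)) : dist (γ t) y = dist x y - t := by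
  have := h.2.2 t ht (dist x y) ⟨dist_nonneg, le_rfl⟩
  rwa [h.2.1, abs_sub_comm, abs_of_nonneg (sub_nonneg.2 ht.2)] at this

theorem IsGeodesicSegment.gp_eq_zero {γ : ℝ → X} {x y : X} (h : IsGeodesicSegment γ x y) {t : ℝ}
    (ht : t ∈ Set.Icc (0 : ℝ) (dist x y)) : gp (γ t) x y = 0 := by
  rw [gp_def, dist_comm _ x, h.dist_left ht, h.dist_right ht]; ring

theorem IsGeodesicSegment.continuousOn {γ : ℝ → X} {x y : X} (h : IsGeodesicSegment γ x y) :
    ContinuousOn γ (Set.Icc 0 (dist x y)) := by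
  refine (LipschitzOnWith.of_dist_le_mul (K := 1) fun s hs t ht => ?_).continuousOn
  rw [h.2.2 s hs t ht, NNReal.coe_one, one_mul, Real.dist_eq]

/-- A point is close to any geodesic on whose endpoints it sees a small Gromov product. -/
theorem FourPoint.dist_geodesic_le {δ : ℝ} (h : FourPoint X δ) {γ : ℝ → X} {x y : X}
    (hγ : IsGeodesicSegment γ x y) (p : X) :
    gp x p y ∈ Set.Icc 0 (dist x y) ∧ dist p (γ (gp x p y)) ≤ gp p x y + 2 * δ := by
  have ht : gp x p y ∈ Set.Icc 0 (dist x y) := ⟨gp_nonneg _ _ _, gp_le_right _ _ _⟩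
  refine ⟨ht, ?_⟩
  have e1 := hγ.dist_left ht
  have e2 := hγ.dist_right ht
  have e3 := h.le_or p x y (γ (gp x p y))
  rw [gp_def p x (γ _), gp_def p (γ _) y, e1, e2] at e3
  have e4 := gp_def x p y
  have e5 := gp_def p x y
  rw [dist_comm x p] at e4
  rcases e3 with e3 | e3 <;> linarith

/-- Bisection of the index interval, each halving costing one `δ`. -/
theorem FourPoint.exists_gp_succ_le {δ : ℝ} (h : FourPoint X δ) (p : X) (u : ℕ → X) (k : ℕ) :
    ∀ i j : ℕ, i < j → j ≤ i + 2 ^ k →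
      ∃ m, i ≤ m ∧ m < j ∧ gp p (u m) (u (m + 1)) ≤ gp p (u i) (u j) + k * δ := by
  have hδ := h.1
  induction k with
  | zero =>
    intro i j h1 h2
    obtain rfl : j = i + 1 := by simp at h2; omega
    exact ⟨i, le_rfl, h1, by simp⟩
  | succ k ih =>
    intro i j h1 h2
    push_cast
    by_cases h3 : j ≤ i + 2 ^ k
    · obtain ⟨m, hm1, hm2, hm3⟩ := ih i j h1 h3
      exact ⟨m, hm1, hm2, by linarith⟩
    · have hp : 0 < 2 ^ k := by positivity
      rw [pow_succ] at h2
      rcases h.le_or p (u i) (u j) (u (i + 2 ^ k)) with h4 | h4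
      · obtain ⟨m, hm1, hm2, hm3⟩ := ih i (i + 2 ^ k) (by omega) le_rfl
        exact ⟨m, hm1, by omega, by linarith⟩
      · obtain ⟨m, hm1, hm2, hm3⟩ := ih (i + 2 ^ k) j (by omega) (by omega)
        exact ⟨m, by omega, hm2, by linarith⟩

/-- The points `u 0, …, u n` form a discrete quasi-geodesic. -/
def IsQuasiGeodesic (R : ℝ) (u : ℕ → X) (n : ℕ) : Prop :=
  ∀ i j : ℕ, i ≤ j → j ≤ n →
    dist (u i) (u j) ≤ R * ((j : ℝ) - i) ∧ (j : ℝ) - i ≤ dist (u i) (u j) + 2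

theorem exists_linear_le_two_pow (a b : ℝ) : ∃ K : ℕ, ∀ k : ℕ, K ≤ k → a + b * k ≤ 2 ^ k := by
  have e1 : Tendsto (fun j : ℕ => ((1 / 2 : ℝ)) ^ j) atTop (𝓝 0) :=
    tendsto_pow_atTop_nhds_zero_of_lt_one (by norm_num) (by norm_num)
  have e2 : Tendsto (fun j : ℕ => (j : ℝ) * ((1 / 2 : ℝ)) ^ j) atTop (𝓝 0) :=
    tendsto_self_mul_const_pow_of_lt_one (by norm_num) (by norm_num)
  have e3 := (e1.const_mul a).add (e2.const_mul b)
  simp only [mul_zero, add_zero] at e3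
  obtain ⟨K, hK⟩ := eventually_atTop.1 (e3.eventually_le_const zero_lt_one)
  refine ⟨K, fun k hk => ?_⟩
  have := hK k hk
  rw [one_div, inv_pow] at this
  have hp : (0 : ℝ) < 2 ^ k := by positivity
  field_simp at this
  linarith

/-- Geodesics stay close to discrete quasi-geodesics with the same endpoints. -/
theorem FourPoint.exists_dist_quasiGeodesic_le {δ : ℝ} (h : FourPoint X δ) {R : ℝ} (hR : 0 ≤ R) :
    ∃ M : ℝ, 0 ≤ M ∧ ∀ (u : ℕ → X) (n : ℕ) (γ : ℝ → X), IsQuasiGeodesic R u n →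
      IsGeodesicSegment γ (u 0) (u n) → ∀ t ∈ Set.Icc 0 (dist (u 0) (u n)),
        ∃ i ≤ n, dist (γ t) (u i) ≤ M := by
  have hδ := h.1
  -- The linear function is `6 * D + 2` for `D = R + (k + 3) * δ`: it bounds the index gap of two
  -- points at distance at most `6 * D`, where `D` is estimated by bisection at scale `k + 1`.
  obtain ⟨K, hK⟩ := exists_linear_le_two_pow (6 * (R + 3 * δ) + 2) (6 * δ)
  refine ⟨R + (K + 2) * δ, by positivity, fun u n γ hu hγ => ?_⟩
  set L := dist (u 0) (u n) with hL
  have hL0 : 0 ≤ L := dist_nonneg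
  set S : Set X := u '' Set.Iic n with hS
  have hSc : IsCompact S := ((Set.finite_Iic n).image u).isCompact
  have hSn : S.Nonempty := ⟨u 0, 0, Nat.zero_le n, rfl⟩
  -- Consider the point of the geodesic that is farthest from the quasi-geodesic, at distance `D`.
  obtain ⟨t₀, ht₀, hmax⟩ := isCompact_Icc.exists_isMaxOn (Set.nonempty_Icc.2 hL0)
    ((Metric.continuous_infDist_pt S).comp_continuousOn hγ.continuousOn)
  set D := Metric.infDist (γ t₀) S with hD
  have hD0 : 0 ≤ D := Metric.infDist_nonneg
  have hfar : ∀ i ≤ n, D ≤ dist (γ t₀) (u i) := fun i hi =>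
    Metric.infDist_le_dist_of_mem ⟨i, hi, rfl⟩
  have hnear : ∀ t ∈ Set.Icc 0 L, ∃ i ≤ n, dist (γ t) (u i) ≤ D := by
    intro t ht
    obtain ⟨_, ⟨i, hi, rfl⟩, hd⟩ := hSc.exists_infDist_eq_dist hSn (γ t)
    exact ⟨i, hi, hd ▸ hmax ht⟩
  suffices hDM : D ≤ R + (K + 2) * δ by
    intro t ht
    obtain ⟨i, hi, hd⟩ := hnear t ht
    exact ⟨i, hi, hd.trans hDM⟩
  -- Go `2 * D` to either side, or to the endpoint if that is nearer. The nearby points of the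
  -- quasi-geodesic then lie in opposite directions as seen from `γ t₀`.
  have hleft : ∃ t₁ ∈ Set.Icc 0 L, t₁ ≤ t₀ ∧ t₀ - t₁ ≤ 2 * D ∧ ∃ i ≤ n,
      dist (γ t₁) (u i) ≤ D ∧ D ≤ gp (γ t₀) (γ t₁) (u i) := by
    by_cases hc : t₀ ≤ 2 * D
    · refine ⟨0, ⟨le_rfl, hL0⟩, ht₀.1, by linarith, 0, Nat.zero_le n, ?_, ?_⟩
      · rwa [hγ.1, dist_self]
      · rw [hγ.1, gp_def, dist_self]
        linarith [hfar 0 (Nat.zero_le n)]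
    · have ht₁ : t₀ - 2 * D ∈ Set.Icc 0 L := ⟨by linarith, by linarith [ht₀.2]⟩
      obtain ⟨i, hi, hd⟩ := hnear _ ht₁
      refine ⟨t₀ - 2 * D, ht₁, by linarith, by linarith, i, hi, hd, ?_⟩
      have e1 := dist_sub_le_gp (γ t₀) (γ (t₀ - 2 * D)) (u i)
      rw [hγ.2.2 _ ht₀ _ ht₁, sub_sub_cancel, abs_of_nonneg (by linarith)] at e1
      linarith
  have hright : ∃ t₂ ∈ Set.Icc 0 L, t₀ ≤ t₂ ∧ t₂ - t₀ ≤ 2 * D ∧ ∃ i ≤ n,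
      dist (γ t₂) (u i) ≤ D ∧ D ≤ gp (γ t₀) (γ t₂) (u i) := by
    by_cases hc : L - t₀ ≤ 2 * D
    · refine ⟨L, ⟨hL0, le_rfl⟩, ht₀.2, by linarith, n, le_rfl, ?_, ?_⟩
      · rwa [hγ.2.1, dist_self]
      · rw [hγ.2.1, gp_def, dist_self]
        linarith [hfar n le_rfl]
    · have ht₂ : t₀ + 2 * D ∈ Set.Icc 0 L := ⟨by linarith [ht₀.1], by linarith⟩
      obtain ⟨i, hi, hd⟩ := hnear _ ht₂
      refine ⟨t₀ + 2 * D, ht₂, by linarith, by linarith, i, hi, hd, ?_⟩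
      have e1 := dist_sub_le_gp (γ t₀) (γ (t₀ + 2 * D)) (u i)
      rw [hγ.2.2 _ ht₀ _ ht₂, sub_add_cancel_left, abs_neg, abs_of_nonneg (by linarith)] at e1
      linarith
  obtain ⟨t₁, ht₁, hle₁, hd₁, i₁, hi₁, hu₁, hg₁⟩ := hleft
  obtain ⟨t₂, ht₂, hle₂, hd₂, i₂, hi₂, hu₂, hg₂⟩ := hright
  by_contra! hlt
  have hKδ : 0 ≤ K * δ := by positivity
  have hg0 : gp (γ t₀) (γ t₁) (γ t₂) = 0 := by
    rw [gp_def, hγ.2.2 _ ht₀ _ ht₁, hγ.2.2 _ ht₀ _ ht₂, hγ.2.2 _ ht₁ _ ht₂,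
      abs_of_nonneg (by linarith), abs_of_nonpos (by linarith), abs_of_nonpos (by linarith)]
    ring
  have hg : gp (γ t₀) (u i₁) (u i₂) ≤ 2 * δ := by
    rcases h.le_or (γ t₀) (γ t₁) (γ t₂) (u i₁) with e | e
    · linarith
    rcases h.le_or (γ t₀) (u i₁) (γ t₂) (u i₂) with e' | e'
    · linarith
    · rw [gp_comm] at e'
      linarith
  have hdist : dist (u i₁) (u i₂) ≤ 6 * D := by
    have e1 := dist_triangle4 (u i₁) (γ t₁) (γ t₂) (u i₂)
    rw [hγ.2.2 _ ht₁ _ ht₂, abs_of_nonpos (by linarith), dist_comm (u i₁) (γ t₁)] at e1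
    linarith
  have hstep : ∀ (k i j : ℕ), i < j → j ≤ n → j ≤ i + 2 ^ k →
      gp (γ t₀) (u i) (u j) ≤ 2 * δ → D ≤ R + (k + 2) * δ := by
    intro k i j hij hj hk hgij
    obtain ⟨m, hm1, hm2, hm3⟩ := h.exists_gp_succ_le (γ t₀) u k i j hij hk
    have e1 := dist_sub_le_gp (γ t₀) (u m) (u (m + 1))
    have e2 := (hu m (m + 1) (Nat.le_succ m) (by omega)).1
    have e3 := hfar m (by omega)
    push_cast at e2
    rw [add_sub_cancel_left, mul_one] at e2
    linarith
  obtain ⟨i, j, hij, hj, hgij, hdij⟩ : ∃ i j : ℕ, i < j ∧ j ≤ n ∧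
      gp (γ t₀) (u i) (u j) ≤ 2 * δ ∧ dist (u i) (u j) ≤ 6 * D := by
    rcases lt_trichotomy i₁ i₂ with hlt' | rfl | hlt'
    · exact ⟨i₁, i₂, hlt', hi₂, hg, hdist⟩
    · rw [gp_def, dist_self] at hg
      linarith [hfar i₁ hi₁]
    · exact ⟨i₂, i₁, hlt', hi₁, by rwa [gp_comm], by rwa [dist_comm]⟩
  have hN := (hu i j hij.le hj).2
  -- If `D` exceeds the bound, the gap `j - i` exceeds every power of two: a gap of at most `2 ^ (K
  -- + k + 1)` bounds `D` by bisection, which in turn bounds the gap by `2 ^ (K + k)`.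
  have hall : ∀ k : ℕ, i + 2 ^ (K + k) < j := by
    intro k
    induction k with
    | zero =>
      by_contra! hle
      exact absurd (hstep K i j hij hj hle hgij) (not_le.2 hlt)
    | succ k ih =>
      by_contra! hle
      have e1 := hstep _ i j hij hj hle hgij
      have e2 := hK (K + k) (by omega)
      have e3 : (i : ℝ) + 2 ^ (K + k) < j := by exact_mod_cast ih
      push_cast at e1 e2
      linarith
  have h1 := hall j
  have h2 := (K + j).lt_two_pow_self
  omega

theorem exists_not_succ_of_zero {P : ℕ → Prop} (h0 : P 0) (N : ℕ) :
    P N ∨ ∃ m < N, P m ∧ ¬ P (m + 1) := by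
  by_contra! h
  refine h.1 ?_
  have : ∀ m ≤ N, P m := by
    intro m
    induction m with
    | zero => exact fun _ => h0
    | succ m ih => exact fun hm => h.2 m (by omega) (ih (by omega))
  exact this N le_rfl

/-- Discrete quasi-geodesics stay close to geodesics with the same endpoints. -/
theorem FourPoint.exists_dist_geodesicSegment_le {δ : ℝ} (h : FourPoint X δ) {R : ℝ}
    (hR : 0 ≤ R) :
    ∃ M : ℝ, 0 ≤ M ∧ ∀ (u : ℕ → X) (n : ℕ) (γ : ℝ → X), IsQuasiGeodesic R u n →
      IsGeodesicSegment γ (u 0) (u n) → ∀ j ≤ n, ∃ t ∈ Set.Icc 0 (dist (u 0) (u n)),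
        dist (u j) (γ t) ≤ M := by
  obtain ⟨M, hM, hmorse⟩ := h.exists_dist_quasiGeodesic_le hR
  refine ⟨R * (2 * M + 3) + M, by positivity, fun u n γ hu hγ j hj => ?_⟩
  set L := dist (u 0) (u n) with hL
  have hL0 : 0 ≤ L := dist_nonneg
  have hmem : ∀ m : ℕ, min (m : ℝ) L ∈ Set.Icc 0 L := fun m =>
    ⟨le_min (Nat.cast_nonneg m) hL0, min_le_right _ _⟩
  have key : ∀ i k : ℕ, ∀ t ∈ Set.Icc 0 L, i ≤ j → j ≤ k → k ≤ n → dist (γ t) (u i) ≤ M →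
      dist (u i) (u k) ≤ 2 * M + 1 → ∃ t ∈ Set.Icc 0 L, dist (u j) (γ t) ≤ R * (2 * M + 3) + M := by
    intro i k t ht hij hjk hkn h1 h2
    refine ⟨t, ht, ?_⟩
    have e1 := (hu i k (hij.trans hjk) hkn).2
    have e2 := (hu i j hij hj).1
    have e3 := dist_triangle (γ t) (u i) (u j)
    have e4 : (j : ℝ) ≤ k := by exact_mod_cast hjk
    have e5 : R * ((j : ℝ) - i) ≤ R * (2 * M + 3) := by gcongr; linarith
    rw [dist_comm]
    linarith
  obtain ⟨N, hN⟩ := exists_nat_ge L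
  -- Moving along the geodesic in unit steps, look for a switch from points near some `u i` with `i
  -- ≤ j` to points near only later `u k`. There `u i` and `u k` are close, hence so are the
  -- indices, which enclose `j`.
  rcases exists_not_succ_of_zero (P := fun m : ℕ => ∃ i ≤ j, dist (γ (min (m : ℝ) L)) (u i) ≤ M)
    ⟨0, Nat.zero_le j, by
      rw [Nat.cast_zero, min_eq_left hL0, hγ.1, dist_self]; exact hM⟩ N with ⟨i, hi, hd⟩ | hcase
  · refine key i n _ (hmem N) hi hj le_rfl hd ?_
    rw [min_eq_right hN, hγ.2.1, dist_comm] at hd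
    linarith
  · obtain ⟨m, -, ⟨i, hi, hd⟩, hnot⟩ := hcase
    obtain ⟨k, hk, hdk⟩ := hmorse u n γ hu hγ _ (hmem (m + 1))
    have hjk : j < k := by
      by_contra! hle
      exact hnot ⟨k, hle, hdk⟩
    refine key i k _ (hmem m) hi hjk.le hk hd ?_
    have e1 := dist_triangle4 (u i) (γ (min (m : ℝ) L)) (γ (min ((m + 1 : ℕ) : ℝ) L)) (u k)
    rw [hγ.2.2 _ (hmem m) _ (hmem (m + 1)), dist_comm (u i) (γ _)] at e1
    have e2 := abs_min_sub_min_le_max (m : ℝ) L ((m + 1 : ℕ) : ℝ) L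
    have e3 : max |(m : ℝ) - ((m + 1 : ℕ) : ℝ)| |L - L| = 1 := by
      push_cast
      simp
    linarith

end Morse

/-! ### Slim triangles and quasi-isometry invariance -/

section QuasiIsometry

variable {X : Type*} [MetricSpace X] {Y : Type*}

/-- `u` restricts to a discrete geodesic from `y` to `z` for the integral distance `D`. -/
def IsDiscreteGeodesic (D : Y → Y → ℕ) (u : ℕ → Y) (y z : Y) : Prop :=
  u 0 = y ∧ u (D y z) = z ∧ ∀ i j : ℕ, i ≤ j → j ≤ D y z → D (u i) (u j) = j - i

theorem IsDiscreteGeodesic.add_eq {D : Y → Y → ℕ} {u : ℕ → Y} {y z : Y}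
    (hu : IsDiscreteGeodesic D u y z) {j : ℕ} (hj : j ≤ D y z) :
    (D y (u j) : ℝ) + D (u j) z = D y z := by
  have h1 := hu.2.2 0 j (Nat.zero_le j) hj
  have h2 := hu.2.2 j _ hj le_rfl
  rw [hu.1] at h1
  rw [hu.2.1] at h2
  have : D y (u j) + D (u j) z = D y z := by omega
  exact_mod_cast this

/-- An integral distance with discrete geodesics and slim triangles is Gromov hyperbolic. -/
theorem isGromovHyperbolic_of_slim (D : Y → Y → ℕ) (h0 : ∀ y, D y y = 0)
    (hsymm : ∀ y z, D y z = D z y) (htri : ∀ x y z, D x z ≤ D x y + D y z)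
    (hgeo : ∀ y z, ∃ u, IsDiscreteGeodesic D u y z) {σ : ℝ} (hσ : 0 ≤ σ)
    (hslim : ∀ y z w u v v', IsDiscreteGeodesic D u y z → IsDiscreteGeodesic D v y w →
      IsDiscreteGeodesic D v' w z → ∀ j ≤ D y z, (∃ i ≤ D y w, (D (u j) (v i) : ℝ) ≤ σ) ∨
        ∃ i ≤ D w z, (D (u j) (v' i) : ℝ) ≤ σ) :
    IsGromovHyperbolic fun y z => (D y z : ℝ) := by
  have htri' : ∀ x y z, (D x z : ℝ) ≤ D x y + D y z := fun x y z => by exact_mod_cast htri x y z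
  -- Up to the error `2 * σ + 1`, the Gromov product is the distance from `x` to a discrete
  -- geodesic; slimness then yields the four point condition.
  have hup : ∀ x y z u, IsDiscreteGeodesic D u y z → ∀ j ≤ D y z,
      gromovProduct (fun y z => (D y z : ℝ)) x y z ≤ D x (u j) := by
    intro x y z u hu j hj
    have e1 := htri' x (u j) y
    have e2 := htri' x (u j) z
    have e3 := hu.add_eq hj
    rw [hsymm (u j) y] at e1
    simp only [gromovProduct]
    linarith
  have hlow : ∀ x y z u, IsDiscreteGeodesic D u y z → ∃ j ≤ D y z,
      (D x (u j) : ℝ) ≤ gromovProduct (fun y z => (D y z : ℝ)) x y z + 2 * σ + 1 := by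
    intro x y z u hu
    obtain ⟨v, hv⟩ := hgeo y x
    obtain ⟨v', hv'⟩ := hgeo x z
    have key : ∀ i j k, j ≤ D y z → i ≤ D y x → k ≤ D x z → (D (u j) (v i) : ℝ) ≤ σ →
        (D (u j) (v' k) : ℝ) ≤ σ + 1 → ∃ j ≤ D y z,
        (D x (u j) : ℝ) ≤ gromovProduct (fun y z => (D y z : ℝ)) x y z + 2 * σ + 1 := by
      intro i j k hj hi hk h1 h2
      refine ⟨j, hj, ?_⟩
      have e1 := hu.add_eq hj
      have e2 := hv.add_eq hi
      have e3 := hv'.add_eq hk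
      have f1 := htri' y (v i) (u j)
      have f2 := htri' x (v i) (u j)
      have f3 := htri' x (v' k) (u j)
      have f4 := htri' (u j) (v' k) z
      rw [hsymm (v i) (u j)] at f1 f2
      rw [hsymm (v i) x] at e2
      rw [hsymm (v' k) (u j)] at f3
      simp only [gromovProduct]
      rw [hsymm x y]
      linarith
    rcases exists_not_succ_of_zero (P := fun j : ℕ => ∃ i ≤ D y x, (D (u j) (v i) : ℝ) ≤ σ)
      ⟨0, Nat.zero_le _, by rw [hu.1, hv.1, h0]; simpa using hσ⟩ (D y z) with ⟨i, hi, hd⟩ | hcase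
    · refine key i _ (D x z) le_rfl hi le_rfl hd ?_
      rw [hu.2.1, hv'.2.1, h0]
      push_cast
      linarith
    · obtain ⟨m, hm, ⟨i, hi, hd⟩, hnot⟩ := hcase
      rcases hslim y z x u v v' hu hv hv' (m + 1) (by omega) with hc | ⟨k, hk, hdk⟩
      · exact absurd hc hnot
      · refine key i m k hm.le hi hk hd ?_
        have e1 := htri' (u m) (u (m + 1)) (v' k)
        rw [hu.2.2 m (m + 1) (by omega) (by omega), Nat.add_sub_cancel_left] at e1
        push_cast at e1
        linarith
  refine ⟨3 * σ + 1, fun x y z w => ?_⟩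
  obtain ⟨u, hu⟩ := hgeo y z
  obtain ⟨v, hv⟩ := hgeo y w
  obtain ⟨v', hv'⟩ := hgeo w z
  obtain ⟨j, hj, hd⟩ := hlow x y z u hu
  rcases hslim y z w u v v' hu hv hv' j hj with ⟨i, hi, hdi⟩ | ⟨i, hi, hdi⟩
  · have e1 := hup x y w v hv i hi
    have e2 := htri' x (u j) (v i)
    have e3 := min_le_left (gromovProduct (fun y z => (D y z : ℝ)) x y w)
      (gromovProduct (fun y z => (D y z : ℝ)) x w z)
    linarith
  · have e1 := hup x w z v' hv' i hi
    have e2 := htri' x (u j) (v' i)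
    have e3 := min_le_right (gromovProduct (fun y z => (D y z : ℝ)) x y w)
      (gromovProduct (fun y z => (D y z : ℝ)) x w z)
    linarith

/-- Gromov hyperbolicity passes to an integral distance with discrete geodesics that embeds
quasi-isometrically into a geodesic hyperbolic space. -/
theorem isGromovHyperbolic_of_quasiIsometric [GeodesicSpace X] [HyperbolicSpace X]
    (D : Y → Y → ℕ) (h0 : ∀ y, D y y = 0)
    (hsymm : ∀ y z, D y z = D z y) (htri : ∀ x y z, D x z ≤ D x y + D y z)
    (hgeo : ∀ y z, ∃ u, IsDiscreteGeodesic D u y z) {R : ℝ} (hR : 0 ≤ R) (f : Y → X)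
    (hf : ∀ y z, dist (f y) (f z) ≤ R * D y z) (hf' : ∀ y z, (D y z : ℝ) ≤ dist (f y) (f z) + 2) :
    IsGromovHyperbolic fun y z => (D y z : ℝ) := by
  obtain ⟨δ, h⟩ := exists_fourPoint X
  have hδ := h.1
  obtain ⟨M, hM, hmorse⟩ := h.exists_dist_quasiGeodesic_le hR
  obtain ⟨M', hM', hmorse'⟩ := h.exists_dist_geodesicSegment_le hR
  have hq : ∀ u y z, IsDiscreteGeodesic D u y z → IsQuasiGeodesic R (f ∘ u) (D y z) := by
    intro u y z hu i j hij hj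
    have e1 := hf (u i) (u j)
    have e2 := hf' (u i) (u j)
    rw [hu.2.2 i j hij hj, Nat.cast_sub hij] at e1 e2
    exact ⟨e1, e2⟩
  have hclose : ∀ u y z p, IsDiscreteGeodesic D u y z → gp p (f y) (f z) ≤ δ →
      ∃ i ≤ D y z, dist p (f (u i)) ≤ 3 * δ + M := by
    intro u y z p hu hp
    obtain ⟨γ, hγ⟩ := GeodesicSpace.exists_geodesic (f y) (f z)
    replace hγ : IsGeodesicSegment γ (f y) (f z) := hγ
    obtain ⟨e1, e2⟩ := h.dist_geodesic_le hγ p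
    have hγ' : IsGeodesicSegment γ ((f ∘ u) 0) ((f ∘ u) (D y z)) := by
      simpa only [Function.comp, hu.1, hu.2.1] using hγ
    obtain ⟨i, hi, hd⟩ := hmorse (f ∘ u) _ γ (hq u y z hu) hγ' (gp (f y) p (f z))
      (by simpa only [Function.comp, hu.1, hu.2.1] using e1)
    refine ⟨i, hi, ?_⟩
    have := dist_triangle p (γ (gp (f y) p (f z))) (f (u i))
    simp only [Function.comp] at hd
    linarith
  -- The terms of `σ` are the distance `M'` to the geodesic in `X`, the distance `3 * δ + M` from
  -- there to another side, and the additive error `2` of `hf'`.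
  refine isGromovHyperbolic_of_slim D h0 hsymm htri hgeo (σ := M' + (3 * δ + M) + 2)
    (by positivity) fun y z w u v v' hu hv hv' j hj => ?_
  obtain ⟨γ, hγ⟩ := GeodesicSpace.exists_geodesic (f y) (f z)
  replace hγ : IsGeodesicSegment γ (f y) (f z) := hγ
  have hγ' : IsGeodesicSegment γ ((f ∘ u) 0) ((f ∘ u) (D y z)) := by
    simpa only [Function.comp, hu.1, hu.2.1] using hγ
  obtain ⟨t, ht, hd⟩ := hmorse' (f ∘ u) _ γ (hq u y z hu) hγ' j hj
  simp only [Function.comp, hu.1, hu.2.1] at ht hd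
  have hg := IsGeodesicSegment.gp_eq_zero hγ ht
  rcases h.le_or (γ t) (f y) (f z) (f w) with e | e
  · obtain ⟨i, hi, hdi⟩ := hclose v y w (γ t) hv (by linarith)
    refine Or.inl ⟨i, hi, ?_⟩
    have e1 := hf' (u j) (v i)
    have e2 := dist_triangle (f (u j)) (γ t) (f (v i))
    linarith
  · obtain ⟨i, hi, hdi⟩ := hclose v' w z (γ t) hv' (by linarith)
    refine Or.inr ⟨i, hi, ?_⟩
    have e1 := hf' (u j) (v' i)
    have e2 := dist_triangle (f (u j)) (γ t) (f (v' i))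
    linarith

end QuasiIsometry

/-! ### Word metrics and the Milnor-Schwarz lemma -/

section WordMetric

variable {G : Type*} [Group G] {S : Set G}

theorem wordLength_le {l : List G} (hl : ∀ s ∈ l, s ∈ S ∨ s⁻¹ ∈ S) :
    wordLength S l.prod ≤ l.length :=
  Nat.sInf_le ⟨l, rfl, hl, rfl⟩

theorem exists_word (hS : Subgroup.closure S = ⊤) (g : G) :
    ∃ l : List G, l.length = wordLength S g ∧ (∀ s ∈ l, s ∈ S ∨ s⁻¹ ∈ S) ∧ l.prod = g := by
  refine Nat.sInf_mem (s := {n : ℕ | ∃ l : List G, l.length = n ∧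
    (∀ s ∈ l, s ∈ S ∨ s⁻¹ ∈ S) ∧ l.prod = g}) ?_
  have hg : g ∈ (Subgroup.closure S).toSubmonoid := hS ▸ Subgroup.mem_top g
  rw [Subgroup.closure_toSubmonoid] at hg
  obtain ⟨l, hl, hp⟩ := Submonoid.exists_list_of_mem_closure hg
  exact ⟨l.length, l, rfl, hl, hp⟩

theorem wordLength_one : wordLength S (1 : G) = 0 := by
  have := wordLength_le (S := S) (l := []) (by simp)
  simpa using this

theorem wordLength_mul_le (hS : Subgroup.closure S = ⊤) (g h : G) :
    wordLength S (g * h) ≤ wordLength S g + wordLength S h := by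
  obtain ⟨l, hl, hlS, rfl⟩ := exists_word hS g
  obtain ⟨k, hk, hkS, rfl⟩ := exists_word hS h
  rw [← hl, ← hk, ← List.length_append, ← List.prod_append]
  refine wordLength_le fun s hs => ?_
  rcases List.mem_append.1 hs with hs | hs
  exacts [hlS s hs, hkS s hs]

theorem wordLength_inv_le (hS : Subgroup.closure S = ⊤) (g : G) :
    wordLength S g⁻¹ ≤ wordLength S g := by
  obtain ⟨l, hl, hlS, hp⟩ := exists_word hS g
  rw [← hl, ← hp, List.prod_inv_reverse]
  refine (wordLength_le fun s hs => ?_).trans (by simp)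
  simp only [List.mem_reverse, List.mem_map] at hs
  obtain ⟨t, ht, rfl⟩ := hs
  rw [inv_inv]
  exact (hlS t ht).symm

theorem wordLength_inv (hS : Subgroup.closure S = ⊤) (g : G) :
    wordLength S g⁻¹ = wordLength S g := by
  refine le_antisymm (wordLength_inv_le hS g) ?_
  simpa using wordLength_inv_le hS g⁻¹

/-- The partial products of a shortest word: if a subword could be shortened, so could the whole
word. -/
theorem exists_isDiscreteGeodesic_word (hS : Subgroup.closure S = ⊤) (g h : G) :
    ∃ u, IsDiscreteGeodesic (fun a b => wordLength S (a⁻¹ * b)) u g h := by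
  obtain ⟨l, hl, hlS, hp⟩ := exists_word hS (g⁻¹ * h)
  have hup : ∀ i j : ℕ, i ≤ j →
      wordLength S ((g * (l.take i).prod)⁻¹ * (g * (l.take j).prod)) ≤ j - i := by
    intro i j hij
    have e1 : (l.take j) = l.take i ++ (l.take j).drop i := by
      conv_lhs => rw [← List.take_append_drop i (l.take j)]
      rw [List.take_take, min_eq_left hij]
    have e2 : (g * (l.take i).prod)⁻¹ * (g * (l.take j).prod) = ((l.take j).drop i).prod := by
      conv_lhs => rw [e1, List.prod_append]
      simp [mul_assoc]
    rw [e2]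
    refine (wordLength_le fun s hs => hlS s ?_).trans ?_
    · exact List.mem_of_mem_take (List.mem_of_mem_drop hs)
    · simp only [List.length_drop, List.length_take]
      omega
  refine ⟨fun i => g * (l.take i).prod, by simp, ?_, fun i j hij hj => ?_⟩
  · simp only [← hl, List.take_length, hp, mul_inv_cancel_left]
  · refine le_antisymm (hup i j hij) ?_
    have h1 := hup 0 i (Nat.zero_le i)
    have h2 := hup j l.length (hl ▸ hj)
    have h3 := wordLength_mul_le hS (g⁻¹ * (g * (l.take i).prod))
      ((g * (l.take i).prod)⁻¹ * (g * (l.take j).prod))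
    have h4 := wordLength_mul_le hS (g⁻¹ * (g * (l.take j).prod))
      ((g * (l.take j).prod)⁻¹ * h)
    rw [List.take_length, hp, mul_inv_cancel_left] at h2
    simp only [List.take_zero, List.prod_nil, mul_one] at h1
    rw [mul_assoc g⁻¹, mul_inv_cancel_left] at h3 h4
    dsimp only at hj ⊢
    omega

theorem dist_smul_prod_le {X : Type*} [MetricSpace X] [MulAction G X] [IsIsometricSMul G X]
    {x : X} {R : ℝ} {l : List G} (hl : ∀ s ∈ l, dist x (s • x) ≤ R) :
    dist x (l.prod • x) ≤ R * l.length := by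
  induction l with
  | nil => simp
  | cons s l ih =>
    have h1 := hl s (by simp)
    have h2 := ih fun t ht => hl t (by simp [ht])
    have h3 := dist_triangle x (s • x) (s • l.prod • x)
    rw [dist_smul] at h3
    rw [List.prod_cons, mul_smul, List.length_cons]
    push_cast
    linarith

/-- The Milnor-Schwarz lemma. -/
theorem exists_word_of_cobounded {X : Type*} [MetricSpace X] [GeodesicSpace X] [MulAction G X]
    [IsIsometricSMul G X] {x : X} {R : ℝ} (hR : ∀ y : X, ∃ g : G, dist (g • x) y ≤ R) (g : G) :
    ∃ l : List G, (∀ s ∈ l, dist x (s • x) ≤ 2 * R + 1) ∧ l.prod = g ∧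
      (l.length : ℝ) ≤ dist x (g • x) + 2 := by
  have hR0 : 0 ≤ R := by
    obtain ⟨k, hk⟩ := hR x
    exact dist_nonneg.trans hk
  obtain ⟨γ, hγ⟩ := GeodesicSpace.exists_geodesic x (g • x)
  replace hγ : IsGeodesicSegment γ x (g • x) := hγ
  set L := dist x (g • x) with hL
  have hL0 : 0 ≤ L := dist_nonneg
  have hmem : ∀ m : ℕ, min (m : ℝ) L ∈ Set.Icc 0 L := fun m =>
    ⟨le_min (Nat.cast_nonneg m) hL0, min_le_right _ _⟩
  -- Orbit points `R`-close to the geodesic at consecutive integer times differ by a generator, as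
  -- `R + 1 + R = 2 * R + 1`. The start may be off `x`, which costs one extra letter.
  have key : ∀ (i : ℕ) (k : G), dist (k • x) (γ (min (i : ℝ) L)) ≤ R →
      ∃ l : List G, (∀ s ∈ l, dist x (s • x) ≤ 2 * R + 1) ∧ l.prod = k ∧ l.length = i + 1 := by
    intro i
    induction i with
    | zero =>
      intro k hk
      rw [Nat.cast_zero, min_eq_left hL0, hγ.1, dist_comm] at hk
      exact ⟨[k], by simp; linarith, by simp, rfl⟩
    | succ i ih =>
      intro k hk
      obtain ⟨a, ha⟩ := hR (γ (min (i : ℝ) L))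
      obtain ⟨l, hl, hp, hn⟩ := ih a ha
      refine ⟨l ++ [a⁻¹ * k], fun s hs => ?_, by simp [hp], by simp [hn]⟩
      rcases List.mem_append.1 hs with hs | hs
      · exact hl s hs
      · obtain rfl := List.mem_singleton.1 hs
        rw [mul_smul, ← dist_smul a, smul_inv_smul]
        have e1 := dist_triangle4 (a • x) (γ (min (i : ℝ) L)) (γ (min ((i + 1 : ℕ) : ℝ) L)) (k • x)
        rw [hγ.2.2 _ (hmem i) _ (hmem (i + 1)), dist_comm (γ _) (k • x)] at e1
        have e2 := abs_min_sub_min_le_max (i : ℝ) L ((i + 1 : ℕ) : ℝ) L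
        have e3 : max |(i : ℝ) - ((i + 1 : ℕ) : ℝ)| |L - L| = 1 := by
          push_cast
          simp
        linarith
  obtain ⟨l, hl, hp, hn⟩ := key ⌈L⌉₊ g (by
    rw [min_eq_right (Nat.le_ceil L), hγ.2.1, dist_self]; exact hR0)
  refine ⟨l, hl, hp, ?_⟩
  have := Nat.ceil_lt_add_one hL0
  rw [hn]
  push_cast
  linarith

/-- A group with a proper cocompact action on a geodesic hyperbolic space is hyperbolic. -/
theorem isHyperbolicGroup_of_cocompact [TopologicalSpace G] {X : Type*} [MetricSpace X]
    [Nonempty X] [GeodesicSpace X] [HyperbolicSpace X] [MulAction G X] [IsIsometricSMul G X]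
    (hp : IsMetricallyProper G X) (hc : IsCocompactAction G X) : IsHyperbolicGroup G := by
  obtain ⟨x⟩ := ‹Nonempty X›
  obtain ⟨K, hK, hcov⟩ := hc
  obtain ⟨R, hKR⟩ := hK.isBounded.subset_closedBall x
  have hR : ∀ y : X, ∃ g : G, dist (g • x) y ≤ R := by
    intro y
    obtain ⟨g, k, hk, rfl⟩ := hcov y
    refine ⟨g, ?_⟩
    rw [dist_smul, dist_comm]
    exact hKR hk
  have hR0 : 0 ≤ R := by
    obtain ⟨k, hk⟩ := hR x
    exact dist_nonneg.trans hk
  set S : Set G := {g : G | dist x (g • x) ≤ 2 * R + 1} with hS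
  have hgen : Subgroup.closure S = ⊤ := by
    refine (Subgroup.eq_top_iff' _).2 fun g => ?_
    obtain ⟨l, hl, rfl, -⟩ := exists_word_of_cobounded hR g
    exact Subgroup.list_prod_mem _ fun s hs => Subgroup.subset_closure (hl s hs)
  refine ⟨S, hp x _, hgen, ?_⟩
  refine isGromovHyperbolic_of_quasiIsometric (X := X) (R := 2 * R + 1)
    (fun a b : G => wordLength S (a⁻¹ * b)) (fun a => by simp [wordLength_one])
    (fun a b => ?_) (fun a b c => ?_) (exists_isDiscreteGeodesic_word hgen) (by linarith)
    (fun a => a • x) (fun a b => ?_) (fun a b => ?_)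
  · rw [← wordLength_inv hgen]
    simp
  · simpa [mul_assoc] using wordLength_mul_le hgen (a⁻¹ * b) (b⁻¹ * c)
  · obtain ⟨l, hl, hlS, hlp⟩ := exists_word hgen (a⁻¹ * b)
    rw [← dist_smul a⁻¹, inv_smul_smul, ← mul_smul, ← hlp, hlp, ← hl, ← hlp]
    refine dist_smul_prod_le fun s hs => ?_
    rcases hlS s hs with h | h
    · exact h
    · rw [← dist_inv_smul_self]
      exact h
  · obtain ⟨l, hl, hlp, hn⟩ := exists_word_of_cobounded hR (a⁻¹ * b)
    have e1 := wordLength_le (S := S) (l := l) fun s hs => Or.inl (hl s hs)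
    rw [hlp] at e1
    have e2 : (wordLength S (a⁻¹ * b) : ℝ) ≤ l.length := by exact_mod_cast e1
    rw [← dist_smul a⁻¹ (a • x), inv_smul_smul, ← mul_smul]
    exact e2.trans hn

end WordMetric

/-! ### Topology of the boundary and bounded parabolic points -/

section BoundaryPoints

variable {X : Type*} [MetricSpace X] [HyperbolicSpace X]

theorem exists_convergesTo (ξ : Boundary X) : ∃ p, ConvergesTo p ξ := by
  induction ξ using Quotient.inductionOn with
  | _ u => exact ⟨u.1, u, rfl, rfl⟩

theorem ConvergesTo.tendsto_gp {p q : ℕ → X} {ξ : Boundary X} (hp : ConvergesTo p ξ)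
    (hq : ConvergesTo q ξ) (x : X) : Tendsto (fun n => gp x (p n) (q n)) atTop atTop := by
  obtain ⟨u, rfl, hu⟩ := hp
  obtain ⟨v, rfl, hv⟩ := hq
  exact Quotient.exact (hu.trans hv.symm) x

theorem ConvergesTo.tendsto_gp_self {p : ℕ → X} {ξ : Boundary X} (hp : ConvergesTo p ξ) (x : X) :
    Tendsto (fun n : ℕ × ℕ => gp x (p n.1) (p n.2)) atTop atTop := by
  obtain ⟨u, rfl, hu⟩ := hp
  exact u.2 x

theorem ConvergesTo.eq_of_tendsto {p q : ℕ → X} {ξ η : Boundary X} (hp : ConvergesTo p ξ)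
    (hq : ConvergesTo q η) {x : X} (h : Tendsto (fun n => gp x (p n) (q n)) atTop atTop) :
    ξ = η := by
  obtain ⟨u, rfl, rfl⟩ := hp
  obtain ⟨v, rfl, rfl⟩ := hq
  exact Quotient.sound fun y => tendsto_gp_base h y

theorem ConvergesTo.exists_frequently_lt {p q : ℕ → X} {ξ η : Boundary X} (hp : ConvergesTo p ξ)
    (hq : ConvergesTo q η) (hne : ξ ≠ η) (x : X) :
    ∃ T : ℝ, ∃ᶠ n in atTop, gp x (p n) (q n) < T := by
  by_contra! h
  refine hne (hp.eq_of_tendsto hq (x := x) (tendsto_atTop.2 fun T => ?_))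
  have := h T
  simpa only [not_frequently, not_lt] using this

theorem ConvergesTo.of_dist_le {p q : ℕ → X} {ξ : Boundary X} (hp : ConvergesTo p ξ) {C : ℝ}
    (hd : ∀ n, dist (p n) (q n) ≤ C) : ConvergesTo q ξ := by
  obtain ⟨u, rfl, rfl⟩ := hp
  have key : ∀ (x : X) (m n : ℕ),
      gp x (u.1 m) (u.1 n) - 2 * C ≤ gp x (q m) (q n) := fun x m n => by
    have h1 := gp_left_le x (u.1 m) (q m) (u.1 n)
    have h2 := gp_right_le x (q m) (u.1 n) (q n)
    have := hd m
    have := hd n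
    linarith
  refine ⟨⟨q, fun x => tendsto_atTop_mono (fun n => ?_)
    (tendsto_atTop_add_const_right _ (-(2 * C)) (u.2 x))⟩, rfl, Quotient.sound fun x =>
      tendsto_atTop_mono (fun n => ?_) (tendsto_atTop_add_const_right _ (-(2 * C))
        ((u.2 x).comp tendsto_atTop_diagonal))⟩
  · exact key x n.1 n.2
  · have h1 := gp_left_le x (u.1 n) (q n) (u.1 n)
    have := hd n
    have := dist_nonneg.trans this
    change gp x (u.1 n) (u.1 n) + -(2 * C) ≤ gp x (q n) (u.1 n)
    linarith

/-- Late terms of `p` have products larger than any product with the fixed point `y`, so their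
products with `y` agree up to `δ`. -/
theorem FourPoint.eventually_le_of_frequently {δ : ℝ} (h : FourPoint X δ) {p : ℕ → X}
    {ξ : Boundary X} (hp : ConvergesTo p ξ) {x y : X} {T : ℝ}
    (hT : ∃ᶠ n in atTop, gp x y (p n) ≤ T) : ∀ᶠ n in atTop, gp x y (p n) ≤ T + δ := by
  obtain ⟨⟨N₁, N₂⟩, hN⟩ := eventually_atTop.1
    ((hp.tendsto_gp_self x).eventually_gt_atTop (dist x y + δ))
  obtain ⟨j, hj, hjT⟩ := frequently_atTop.1 hT N₂
  filter_upwards [eventually_ge_atTop N₁] with k hk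
  have e1 := hN (k, j) ⟨hk, hj⟩
  have e2 := gp_le_left x y (p j)
  dsimp only at e1
  rcases h.le_or x y (p j) (p k) with e | e <;> linarith

theorem FourPoint.eventually_gp_le_add {δ : ℝ} (h : FourPoint X δ) {p q : ℕ → X} {ξ : Boundary X}
    (hp : ConvergesTo p ξ) (hq : ConvergesTo q ξ) (x y : X) :
    ∀ᶠ n in atTop, gp x y (q n) ≤ gp x y (p n) + δ := by
  filter_upwards [(hp.tendsto_gp hq x).eventually_gt_atTop (dist x y + δ)] with n hn
  have e1 := gp_le_left x y (p n)
  rw [gp_comm] at hn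
  rcases h.le_or x y (p n) (q n) with e | e <;> linarith

theorem FourPoint.eventually_le_of_boundaryClose {δ : ℝ} (h : FourPoint X δ) {x : X} {r : ℝ}
    {ξ η : Boundary X} (hc : BoundaryClose x r ξ η) {p q : ℕ → X} (hp : ConvergesTo p ξ)
    (hq : ConvergesTo q η) : ∀ᶠ n in atTop, r - 2 * δ ≤ gp x (p n) (q n) := by
  have hδ := h.1
  obtain ⟨p', q', hp', hq', hc⟩ := hc
  filter_upwards [hc, (hp.tendsto_gp hp' x).eventually_ge_atTop r,
    (hq'.tendsto_gp hq x).eventually_ge_atTop r] with n h1 h2 h3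
  have h4 := h.ge h2 h1
  have h5 := h.ge h4 (show r - δ ≤ _ by linarith)
  linarith

theorem BoundaryClose.symm {x : X} {r : ℝ} {ξ η : Boundary X} (h : BoundaryClose x r ξ η) :
    BoundaryClose x r η ξ := by
  obtain ⟨p, q, hp, hq, hpq⟩ := h
  exact ⟨q, p, hq, hp, hpq.mono fun n hn => by rwa [gp_comm]⟩

theorem BoundaryClose.refl (x : X) (r : ℝ) (ξ : Boundary X) : BoundaryClose x r ξ ξ := by
  obtain ⟨p, hp⟩ := exists_convergesTo ξ
  exact ⟨p, p, hp, hp, (hp.tendsto_gp hp x).eventually_ge_atTop r⟩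

theorem FourPoint.boundaryClose_trans {δ : ℝ} (h : FourPoint X δ) {x : X} {r : ℝ}
    {ξ η ζ : Boundary X} (h1 : BoundaryClose x r ξ η) (h2 : BoundaryClose x r η ζ) :
    BoundaryClose x (r - 2 * δ) ξ ζ := by
  have hδ := h.1
  obtain ⟨p, q, hp, hq, hpq⟩ := h1
  obtain ⟨q', s, hq', hs, hqs⟩ := h2
  refine ⟨p, s, hp, hs, ?_⟩
  filter_upwards [hpq, hqs, (hq.tendsto_gp hq' x).eventually_ge_atTop r] with n e1 e2 e3
  have e4 := h.ge e1 e3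
  have e5 := h.ge e4 (show r - δ ≤ _ by linarith)
  linarith

theorem BoundaryClose.mono {x : X} {r s : ℝ} {ξ η : Boundary X} (h : BoundaryClose x r ξ η)
    (hs : s ≤ r) : BoundaryClose x s ξ η := by
  obtain ⟨p, q, hp, hq, hpq⟩ := h
  exact ⟨p, q, hp, hq, hpq.mono fun n hn => hs.trans hn⟩

theorem BoundaryClose.base {x y : X} {r : ℝ} {ξ η : Boundary X} (h : BoundaryClose x r ξ η) :
    BoundaryClose y (r - dist x y) ξ η := by
  obtain ⟨p, q, hp, hq, hpq⟩ := h
  refine ⟨p, q, hp, hq, hpq.mono fun n hn => ?_⟩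
  have := gp_base_le x y (p n) (q n)
  linarith

/-- The boundary points that are reached from `ξ` by chains of `k` steps, the `i`-th of which is
`(r + c i)`-close. -/
def boundaryChain (x : X) (c : ℝ) : ℕ → ℝ → Boundary X → Set (Boundary X)
  | 0, _, ξ => {ξ}
  | k + 1, r, ξ => {ζ | ∃ η, BoundaryClose x r ξ η ∧ ζ ∈ boundaryChain x c k (r + c) η}

theorem boundaryChain_append {x : X} {c : ℝ} {k : ℕ} {r : ℝ} {ξ η ζ : Boundary X}
    (h1 : η ∈ boundaryChain x c k r ξ) (h2 : BoundaryClose x (r + k * c) η ζ) :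
    ζ ∈ boundaryChain x c (k + 1) r ξ := by
  induction k generalizing r ξ with
  | zero =>
    obtain rfl : η = ξ := h1
    exact ⟨ζ, by simpa using h2, rfl⟩
  | succ k ih =>
    obtain ⟨θ, hθ, hη⟩ := h1
    exact ⟨θ, hθ, ih hη (by convert h2 using 1; push_cast; ring)⟩

/-- The sets of `r`-close points need not be open. Since chains may be prolonged by a sufficiently
tight link, their union is. -/
theorem isOpen_iUnion_boundaryChain (x : X) (c r : ℝ) (ξ : Boundary X) :
    IsOpen (⋃ k, boundaryChain x c k r ξ) := by
  intro η hη y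
  obtain ⟨k, hk⟩ := Set.mem_iUnion.1 hη
  refine ⟨r + k * c + dist y x, fun ζ hζ => Set.mem_iUnion.2 ⟨k + 1, boundaryChain_append hk ?_⟩⟩
  convert hζ.base (y := x) using 1
  ring

/-- Composing from the far end, the loss `2 * δ` of each composition is made up by the tighter
closeness of the later links. -/
theorem FourPoint.boundaryClose_of_mem_chain {δ : ℝ} (h : FourPoint X δ) {x : X} {k : ℕ} {r : ℝ}
    {ξ ζ : Boundary X} (hζ : ζ ∈ boundaryChain x (2 * δ) k r ξ) :
    BoundaryClose x (r - 2 * δ) ξ ζ := by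
  induction k generalizing r ξ with
  | zero =>
    obtain rfl : ζ = ξ := hζ
    exact BoundaryClose.refl _ _ _
  | succ k ih =>
    obtain ⟨η, hη, hζ⟩ := hζ
    exact h.boundaryClose_trans hη ((ih hζ).mono (by linarith))

/-- Compact subsets of the boundary are bounded away from the points in their complement. -/
theorem exists_not_boundaryClose_of_isCompact {K : Set (Boundary X)} (hK : IsCompact K)
    {ξ : Boundary X} (hξ : ξ ∉ K) (x : X) : ∃ r : ℝ, ∀ κ ∈ K, ¬ BoundaryClose x r ξ κ := by
  obtain ⟨δ, h⟩ := exists_fourPoint X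
  have hδ := h.1
  refine hK.induction_on (p := fun K => ∃ r : ℝ, ∀ κ ∈ K, ¬ BoundaryClose x r ξ κ)
    ⟨0, by simp⟩ (fun s t hst ⟨r, hr⟩ => ⟨r, fun κ hκ => hr κ (hst hκ)⟩) ?_ ?_
  · rintro s t ⟨r, hr⟩ ⟨r', hr'⟩
    refine ⟨max r r', ?_⟩
    rintro κ (hκ | hκ) hc
    · exact hr κ hκ (hc.mono (le_max_left _ _))
    · exact hr' κ hκ (hc.mono (le_max_right _ _))
  · intro ζ hζ
    obtain ⟨p, hp⟩ := exists_convergesTo ξ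
    obtain ⟨q, hq⟩ := exists_convergesTo ζ
    obtain ⟨T, hT⟩ := hp.exists_frequently_lt hq (fun e => hξ (e ▸ hζ)) x
    -- The chain, the composition and the change of representatives each cost `2 * δ`, hence `T + 6
    -- * δ`.
    refine ⟨_, mem_nhdsWithin_of_mem_nhds
      ((isOpen_iUnion_boundaryChain x (2 * δ) (T + 6 * δ) ζ).mem_nhds
        (Set.mem_iUnion.2 ⟨0, rfl⟩)), T + 4 * δ, fun κ hκ hc => ?_⟩
    obtain ⟨k, hk⟩ := Set.mem_iUnion.1 hκ
    have h1 := h.boundaryClose_of_mem_chain hk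
    have h2 := h.boundaryClose_trans hc (h1.mono (by linarith)).symm
    obtain ⟨n, hn1, hn2⟩ := (hT.and_eventually (h.eventually_le_of_boundaryClose h2 hp hq)).exists
    linarith

variable {G : Type*} [Group G] [MulAction G X] [IsIsometricSMul G X]

theorem ConvergesTo.smul {p : ℕ → X} {ξ : Boundary X} (hp : ConvergesTo p ξ) (g : G) :
    ConvergesTo (fun n => g • p n) (g • ξ) := by
  obtain ⟨u, rfl, rfl⟩ := hp
  exact ⟨u.translate g, rfl, rfl⟩

theorem mem_endpoints_iff {g : G} {ξ : Boundary X} (x : X) :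
    ξ ∈ endpoints X g ↔ ∃ z : ℕ → ℤ, ConvergesTo (fun n => g ^ z n • x) ξ := by
  constructor
  · rintro ⟨y, h, hmem, hξ⟩
    choose z hz using fun n => Subgroup.mem_zpowers_iff.1 (hmem n)
    refine ⟨z, hξ.of_dist_le (C := dist y x) fun n => ?_⟩
    rw [← hz, dist_smul]
  · rintro ⟨z, hz⟩
    exact ⟨x, fun n => g ^ z n, fun n => Subgroup.zpow_mem_zpowers g (z n), hz⟩

theorem inv_smul_mem_endpoints {g a : G} {ξ : Boundary X} (x : X)
    (h : ξ ∈ endpoints X (a * g * a⁻¹)) : a⁻¹ • ξ ∈ endpoints X g := by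
  obtain ⟨z, hz⟩ := (mem_endpoints_iff (a • x)).1 h
  refine (mem_endpoints_iff x).2 ⟨z, ?_⟩
  convert hz.smul a⁻¹ using 2 with n
  rw [conj_zpow, mul_smul, mul_smul, inv_smul_smul, inv_smul_smul]

/-- A bounded parabolic point with bounded stabilizer is isolated. -/
theorem IsBoundedParabolic.isOpen {ξ : Boundary X} (hξ : IsBoundedParabolic G ξ) {x : X} {B : ℝ}
    (hB : ∀ a : G, a • ξ = ξ → dist x (a • x) ≤ B) : IsOpen {ξ} := by
  obtain ⟨K, hK, hKξ, hcov⟩ := hξ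
  obtain ⟨r, hr⟩ := exists_not_boundaryClose_of_isCompact hK (fun h => hKξ h rfl) x
  rintro _ rfl y
  rename_i ξ
  -- A point near ξ is carried into `K` by an element fixing ξ. This moves the base point by at most
  -- `B`, so the image would still be too close to ξ.
  refine ⟨r + B + dist y x, fun η hη => ?_⟩
  by_contra hne
  obtain ⟨g, hg, κ, hκ, rfl⟩ := hcov η hne
  obtain ⟨p, q, hp, hq, hpq⟩ := hη
  have hg' : g⁻¹ • ξ = ξ := by rw [inv_smul_eq_iff, MulAction.mem_stabilizer_iff.1 hg]
  refine hr κ hκ ⟨_, _, hg' ▸ hp.smul g⁻¹, inv_smul_smul g κ ▸ hq.smul g⁻¹, hpq.mono fun n hn => ?_⟩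
  have e1 := gp_base_le y x (p n) (q n)
  have e2 := gp_base_le x (g • x) (p n) (q n)
  have e3 := hB g (MulAction.mem_stabilizer_iff.1 hg)
  rw [gp_smul_left] at e2
  linarith

end BoundaryPoints

/-! ### Radial sequences and stabilizers of boundary points -/

section Radial

variable {X : Type*} [MetricSpace X] (G : Type*) [Group G] [MulAction G X]

/-- The sequence `p` is approached by the orbit of `x` within bounded distance of the geodesics
from `x` to `p n`. -/
def IsRadial (x : X) (p : ℕ → X) : Prop :=
  ∃ C : ℝ, ∀ N : ℝ, ∃ g : G, N ≤ dist x (g • x) ∧ ∀ᶠ k in atTop, gp (g • x) x (p k) ≤ C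

variable {G}

/-- A radial orbit point `g • x` is within `C + 2 * δ` of the ray at a time at least `dist x (g • x)
- C`, but there the ray is far from the orbit. -/
theorem FourPoint.not_isRadial_of_ray {δ : ℝ} (h : FourPoint X δ) {ρ : ℝ → X} {x : X}
    (h0 : ρ 0 = x) (hρ : ∀ s t : ℝ, 0 ≤ s → 0 ≤ t → dist (ρ s) (ρ t) = |s - t|)
    (hfar : ∀ t : ℝ, 0 ≤ t → ∀ g : G, t - 1 ≤ dist (ρ t) (g • x)) :
    ¬ IsRadial G x fun n : ℕ => ρ n := by
  rintro ⟨C, hC⟩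
  obtain ⟨g, hg, hk⟩ := hC (2 * C + 2 * δ + 2)
  obtain ⟨k, hk⟩ := hk.exists
  have hd : dist x (ρ k) = k := by
    rw [← h0, hρ 0 k le_rfl (Nat.cast_nonneg k), zero_sub, abs_neg,
      abs_of_nonneg (Nat.cast_nonneg k)]
  have hseg : IsGeodesicSegment ρ x (ρ k) :=
    ⟨h0, by rw [hd], fun s hs t ht => hρ s t hs.1 ht.1⟩
  obtain ⟨e1, e2⟩ := h.dist_geodesic_le hseg (g • x)
  have e3 := hfar _ e1.1 g
  have e4 := gp_add_gp x (g • x) (ρ k)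
  rw [dist_comm] at e3
  linarith

variable [IsIsometricSMul G X]

/-- Of two radial orbit points, the nearer one `g • x` lies almost between `x` and the much farther
`k • x`. Translation by `g⁻¹` gives far orbit points with a small Gromov product, against
`FourPoint.gp_smul_smul_ge`. -/
theorem FourPoint.not_isRadial_of_forall_not_isHyperbolicElement {δ : ℝ} (h : FourPoint X δ)
    (hG : ∀ g : G, ¬ IsHyperbolicElement X g) (x : X) (p : ℕ → X) : ¬ IsRadial G x p := by
  rintro ⟨C, hC⟩
  have hδ := h.1
  obtain ⟨g, hg, hgp⟩ := hC (2 * (C + 6 * δ) + 1)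
  obtain ⟨k, hk, hkp⟩ := hC (2 * dist x (g • x))
  obtain ⟨n, hn1, hn2⟩ := (hgp.and hkp).exists
  have e1 := gp_add_gp x (g • x) (p n)
  have e2 := gp_add_gp x (k • x) (p n)
  have e0 : 0 ≤ dist x (g • x) := dist_nonneg
  have e3 := h.ge (show dist x (g • x) - C ≤ gp x (g • x) (p n) by linarith)
    (show dist x (g • x) - C ≤ gp x (p n) (k • x) by rw [gp_comm]; linarith)
  have e4 := gp_add_gp x (g • x) (k • x)
  have e5 := h.gp_smul_smul_ge hG x g⁻¹ (g⁻¹ * k)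
  rw [mul_smul, ← gp_smul_left, dist_inv_smul_self] at e5
  have e6 : dist x (g⁻¹ • k • x) = dist (g • x) (k • x) := by
    rw [← dist_smul g, smul_inv_smul]
  have e7 := dist_triangle x (g • x) (k • x)
  rw [e6, min_eq_left (by linarith)] at e5
  linarith

variable [HyperbolicSpace X]

theorem IsConicalLimitPoint.isRadial {ξ : Boundary X} (hξ : IsConicalLimitPoint G ξ) {p : ℕ → X}
    (hp : ConvergesTo p ξ) (x : X) : IsRadial G x p := by
  obtain ⟨δ, h⟩ := exists_fourPoint X
  obtain ⟨γ, hγ, hγξ, r, y, hunb⟩ := hξ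
  refine ⟨dist x y + r + dist x (γ 0) + δ, fun N => ?_⟩
  obtain ⟨z, ⟨⟨g, rfl⟩, hz⟩, hN⟩ : ∃ z ∈ MulAction.orbit G y ∩ Metric.thickening r (Set.range γ),
      N + 2 * dist x y < dist z y := by
    by_contra! hcon
    exact hunb ((Metric.isBounded_closedBall (x := y) (r := N + 2 * dist x y)).subset hcon)
  obtain ⟨_, ⟨s, rfl⟩, hs⟩ := Metric.mem_thickening_iff.1 hz
  dsimp only at hs hN
  refine ⟨g, ?_, ?_⟩
  · have := dist_smul_smul_le g y x
    rw [dist_comm (g • y), dist_comm x y] at hN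
    linarith
  obtain ⟨N₀, hN₀⟩ := exists_nat_ge (s : ℝ)
  filter_upwards [(hp.tendsto_gp hγξ (g • x)).eventually_gt_atTop
    (dist x y + r + dist x (γ 0) + δ), eventually_ge_atTop N₀] with k hk hk'
  have e0 : gp (γ s) (γ 0) (γ (k : NNReal)) = 0 := by
    have hsk : (s : ℝ) ≤ k := hN₀.trans (by exact_mod_cast hk')
    rw [gp_def, hγ.dist_eq, hγ.dist_eq, hγ.dist_eq, NNReal.dist_eq, NNReal.dist_eq, NNReal.dist_eq,
      NNReal.coe_zero, NNReal.coe_natCast, sub_zero, zero_sub, abs_neg, NNReal.abs_eq,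
      abs_of_nonpos (by linarith), abs_of_nonneg (Nat.cast_nonneg k)]
    ring
  have e1 := gp_base_le (g • x) (γ s) x (γ (k : NNReal))
  have e2 := gp_left_le (γ s) x (γ 0) (γ (k : NNReal))
  have e3 := dist_triangle (g • x) (g • y) (γ s)
  rw [dist_smul] at e3
  rcases h.le_or (g • x) x (γ (k : NNReal)) (p k) with e | e <;> linarith

/-- The products `(ax|q)_x` and `(x|q)_{ax}` add up to the displacement of `a`. Translating the
second by `a⁻¹` turns `q` into a sequence converging to ξ. -/
theorem FourPoint.eventually_le_add_gp {δ : ℝ} (h : FourPoint X δ) {p q : ℕ → X}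
    {ξ : Boundary X} {a : G} (hp : ConvergesTo p ξ) (hq : ConvergesTo q (a • ξ)) (x : X) :
    ∀ᶠ k in atTop, dist x (a • x) - δ ≤ gp x (a • x) (q k) + gp x (a⁻¹ • x) (p k) := by
  have hq' := hq.smul a⁻¹
  rw [inv_smul_smul] at hq'
  filter_upwards [h.eventually_gp_le_add hp hq' x (a⁻¹ • x)] with k hk
  have e1 := gp_add_gp x (a • x) (q k)
  rw [gp_smul_left] at e1
  linarith

/-- Nonhyperbolic elements move a base point towards their fixed points at infinity. -/
theorem FourPoint.eventually_half_le_gp {δ : ℝ} (h : FourPoint X δ) {p : ℕ → X} {ξ : Boundary X}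
    (hp : ConvergesTo p ξ) {a : G} (ha : ¬ IsHyperbolicElement X a) (haξ : a • ξ = ξ) (x : X) :
    ∀ᶠ k in atTop, dist x (a • x) / 2 - 2 * δ ≤ gp x (a • x) (p k) := by
  have hδ := h.1
  filter_upwards [h.eventually_le_add_gp (a := a) hp (by rwa [haξ]) x] with k hk
  have e1 := h.gp_inv_ge ha x
  rcases le_total (dist x (a • x) / 2 - δ) (gp x (a⁻¹ • x) (p k)) with e | e
  · rw [gp_comm] at e1
    have := h.ge e1 e
    linarith
  · linarith

/-- The radial orbit points are the `(a n)⁻¹ • x`: translation by `a n` changes `p` only to an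
equivalent sequence. -/
theorem FourPoint.isRadial_of_seq {δ : ℝ} (h : FourPoint X δ) {p : ℕ → X} {ξ : Boundary X}
    (hp : ConvergesTo p ξ) {x : X} {a : ℕ → G} (ha : ∀ n, a n • ξ = ξ)
    (hlim : Tendsto (fun n => dist x (a n • x)) atTop atTop) {C : ℝ}
    (hC : ∀ n, ∀ᶠ k in atTop, gp x (a n • x) (p k) ≤ C) : IsRadial G x p := by
  refine ⟨C + δ, fun N => ?_⟩
  obtain ⟨n, hn⟩ := (hlim.eventually_ge_atTop N).exists
  refine ⟨(a n)⁻¹, by rwa [dist_inv_smul_self], ?_⟩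
  have hp' := hp.smul (a n)
  rw [ha n] at hp'
  filter_upwards [hC n, h.eventually_gp_le_add hp hp' x (a n • x)] with k h1 h2
  rw [gp_smul_left, inv_inv]
  linarith

/-- The two halves of an orbit of `a` diverge, so ξ is away from at least one of them, to which
`FourPoint.isRadial_of_seq` applies. -/
theorem IsHyperbolicElement.isRadial {a : G} (ha : IsHyperbolicElement X a) {p : ℕ → X}
    {ξ : Boundary X} (hp : ConvergesTo p ξ) (haξ : a • ξ = ξ) (x : X) : IsRadial G x p := by
  obtain ⟨δ, h⟩ := exists_fourPoint X
  obtain ⟨C, hC⟩ := h.exists_gp_pow_le ha x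
  have hfix : ∀ b : G, b • ξ = ξ → ∀ n : ℕ, b ^ n • ξ = ξ := fun b hb n => by
    induction n with
    | zero => simp
    | succ n ih => rw [pow_succ, mul_smul, hb, ih]
  by_cases hcase : ∀ n : ℕ, ∃ᶠ k in atTop, gp x (a ^ n • x) (p k) ≤ C + δ
  · exact h.isRadial_of_seq hp (hfix a haξ) (ha.tendsto_dist x)
      fun n => h.eventually_le_of_frequently hp (hcase n)
  · push Not at hcase
    obtain ⟨n, hn⟩ := hcase
    refine h.isRadial_of_seq hp (hfix a⁻¹ (by rw [inv_smul_eq_iff, haξ]))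
      (ha.inv.tendsto_dist x) (C := C + δ) fun m => ?_
    filter_upwards [hn] with k hk
    rcases h.le_or x ((a⁻¹) ^ m • x) (a ^ n • x) (p k) with e | e
    · have := hC m n
      linarith
    · have := hC m n
      rw [gp_comm] at e
      linarith

/-- If the products were unbounded, `p` would follow the orbit of `g`, whose points would make it
radial. -/
theorem IsHyperbolicElement.exists_gp_pow_le {g : G} (hg : IsHyperbolicElement X g) {p : ℕ → X}
    {ξ : Boundary X} (hp : ConvergesTo p ξ) {x : X} (hr : ¬ IsRadial G x p) :
    ∃ T : ℝ, ∀ n : ℕ, ∀ᶠ k in atTop, gp x (g ^ n • x) (p k) ≤ T := by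
  obtain ⟨δ, h⟩ := exists_fourPoint X
  obtain ⟨C, hC⟩ := h.exists_gp_pow_le hg x
  by_contra! hcon
  refine hr ⟨C + δ + δ, fun N => ?_⟩
  obtain ⟨m, hm⟩ := ((hg.tendsto_dist x).eventually_ge_atTop N).exists
  refine ⟨g ^ m, hm, h.eventually_le_of_frequently hp ?_⟩
  obtain ⟨n, hn⟩ := hcon (max (m * dist x (g • x)) (dist x (g ^ m • x) + C + δ))
  have hmn : m ≤ n := by
    obtain ⟨k, hk⟩ := hn.exists
    by_contra! hlt
    have e1 := gp_le_left x (g ^ n • x) (p k)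
    have e2 := dist_pow_smul_le g x n
    have e3 : (n : ℝ) * dist x (g • x) ≤ m * dist x (g • x) := by gcongr
    have e4 := le_max_left (m * dist x (g • x)) (dist x (g ^ m • x) + C + δ)
    linarith
  obtain ⟨j, rfl⟩ := Nat.exists_eq_add_of_le hmn
  have e1 : gp (g ^ m • x) x (g ^ (m + j) • x) ≤ C := by
    rw [gp_smul_left, pow_add, mul_smul, inv_smul_smul, ← inv_pow]
    exact hC m j
  refine hn.mono fun k hk => ?_
  have e2 := le_max_right (m * dist x (g • x)) (dist x (g ^ m • x) + C + δ)
  have e3 := gp_base_le x (g ^ m • x) (g ^ (m + j) • x) (p k)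
  rcases h.le_or (g ^ m • x) x (g ^ (m + j) • x) (p k) with e | e
  · linarith
  · rw [gp_comm] at e
    linarith

theorem IsHyperbolicElement.exists_gp_zpow_le {g : G} (hg : IsHyperbolicElement X g) {p : ℕ → X}
    {ξ : Boundary X} (hp : ConvergesTo p ξ) {x : X} (hr : ¬ IsRadial G x p) :
    ∃ T : ℝ, ∀ n : ℤ, ∀ᶠ k in atTop, gp x (g ^ n • x) (p k) ≤ T := by
  obtain ⟨T, hT⟩ := hg.exists_gp_pow_le hp hr
  obtain ⟨T', hT'⟩ := hg.inv.exists_gp_pow_le hp hr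
  refine ⟨max T T', fun n => ?_⟩
  obtain ⟨n, rfl | rfl⟩ := n.eq_nat_or_neg
  · simp only [zpow_natCast]
    exact (hT n).mono fun k hk => hk.trans (le_max_left _ _)
  · simp only [zpow_neg, zpow_natCast, ← inv_pow]
    exact (hT' n).mono fun k hk => hk.trans (le_max_right _ _)

/-- If the action is not of general type but has hyperbolic elements, then stabilizers of
boundary points that are not radial have bounded orbits. -/
theorem exists_dist_le_of_not_isGeneralType {g : G} (hg : IsHyperbolicElement X g)
    (hG : ¬ IsGeneralType G X) {p : ℕ → X} {ξ : Boundary X} (hp : ConvergesTo p ξ) {x : X}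
    (hr : ¬ IsRadial G x p) : ∃ B : ℝ, ∀ a : G, a • ξ = ξ → dist x (a • x) ≤ B := by
  obtain ⟨δ, h⟩ := exists_fourPoint X
  have hδ := h.1
  obtain ⟨T, hT⟩ := hg.exists_gp_zpow_le hp hr
  refine ⟨2 * T + 6 * δ, fun a ha => ?_⟩
  have hna : ¬ IsHyperbolicElement X a := fun hc => hr (hc.isRadial hp ha x)
  have ha' : a⁻¹ • ξ = ξ := by rw [inv_smul_eq_iff, ha]
  have hna' : ¬ IsHyperbolicElement X a⁻¹ := fun hc => hr (hc.isRadial hp ha' x)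
  have hmeet : ¬ Disjoint (endpoints X g) (endpoints X (a * g * a⁻¹)) :=
    fun hd => hG ⟨g, a * g * a⁻¹, hg, hg.conj a, hd⟩
  obtain ⟨ζ, hζ, hζ'⟩ := Set.not_disjoint_iff.1 hmeet
  obtain ⟨z, hz⟩ := (mem_endpoints_iff x).1 hζ
  obtain ⟨z', hz'⟩ := (mem_endpoints_iff x).1 (inv_smul_mem_endpoints x hζ')
  -- From `x`, the point `a • x` has a large product with `g ^ z j • x`, or `a⁻¹ • x` has one with
  -- `g ^ z' j • x`. Both `a • x` and `a⁻¹ • x` lie towards ξ, while the powers of `g` do not.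
  obtain ⟨j, hj⟩ := (h.eventually_le_add_gp (a := a) hz' (by rwa [smul_inv_smul]) x).exists
  obtain ⟨k, ⟨e1, e2⟩, e3, e4⟩ := (((h.eventually_half_le_gp hp hna ha x).and
    (h.eventually_half_le_gp hp hna' ha' x)).and ((hT (z j)).and (hT (z' j)))).exists
  rw [dist_inv_smul_self] at e2
  rcases le_total (dist x (a • x) / 2 - 2 * δ) (gp x (a • x) (g ^ z j • x)) with e | e
  · rw [gp_comm] at e
    have := h.ge e e1
    linarith
  · have e' : dist x (a • x) / 2 - 2 * δ ≤ gp x (a⁻¹ • x) (g ^ z' j • x) := by linarith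
    rw [gp_comm] at e'
    have := h.ge e' e2
    linarith

/-- For an action without hyperbolic elements on a space with a non-isolated boundary point, some
boundary point has a stabilizer with bounded orbits. -/
theorem exists_dist_le_of_forall_not_isHyperbolicElement
    (hG : ∀ g : G, ¬ IsHyperbolicElement X g) {p : ℕ → X} {ξ : Boundary X} (hp : ConvergesTo p ξ)
    (hiso : ¬ IsOpen {ξ}) (x : X) : ∃ η : Boundary X, ∃ B : ℝ,
      ∀ a : G, a • η = η → dist x (a • x) ≤ B := by
  obtain ⟨δ, h⟩ := exists_fourPoint X
  have hδ := h.1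
  -- Either the orbit stays away from ξ and ξ itself serves, or the orbit accumulates at ξ. In the
  -- latter case any `η ≠ ξ` serves: elements fixing η move `x` towards η, but far orbit points all
  -- lie towards ξ.
  by_cases hcase : ∃ T : ℝ, ∀ g : G, ∃ᶠ k in atTop, gp x (g • x) (p k) ≤ T
  · obtain ⟨T, hT⟩ := hcase
    refine ⟨ξ, 2 * T + 4 * δ, fun a ha => ?_⟩
    obtain ⟨k, hk1, hk2⟩ :=
      ((hT a).and_eventually (h.eventually_half_le_gp hp (hG a) ha x)).exists
    linarith
  · push Not at hcase
    obtain ⟨η, hη⟩ : ∃ η, η ≠ ξ := by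
      by_contra! hall
      refine hiso ?_
      rw [Set.eq_univ_of_forall (s := {ξ}) fun η => hall η]
      exact isOpen_univ
    obtain ⟨q, hq⟩ := exists_convergesTo η
    obtain ⟨T, hT⟩ := hp.exists_frequently_lt hq hη.symm x
    refine ⟨η, 2 * T + 14 * δ, fun a ha => ?_⟩
    obtain ⟨g, hg⟩ := hcase (max (dist x (a • x)) (T + δ))
    obtain ⟨k, e1, e2, e3⟩ := (hT.and_eventually
      (hg.and (h.eventually_half_le_gp hq (hG a) ha x))).exists
    have m1 := le_max_left (dist x (a • x)) (T + δ)
    have m2 := le_max_right (dist x (a • x)) (T + δ)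
    have e4 := h.gp_smul_smul_ge hG x a g
    have e5 := gp_le_left x (g • x) (p k)
    rw [min_eq_left (by linarith), gp_comm] at e4
    have e6 := h.ge (show dist x (a • x) / 2 - 5 * δ ≤ _ from e4)
      (show dist x (a • x) / 2 - 5 * δ ≤ gp x (a • x) (q k) by linarith)
    rcases h.le_or x (p k) (q k) (g • x) with e | e
    · rw [gp_comm] at e
      linarith
    · linarith

end Radial

/-! ### Cocompact or of general type -/

section Main

variable {X : Type*} [MetricSpace X] {G : Type*} [Group G] [MulAction G X] [IsIsometricSMul G X]

/-- An action that is not cocompact has a geodesic ray which moves away from the orbit of its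
origin as fast as possible. -/
theorem exists_ray_of_not_isCocompactAction [ProperSpace X] [GeodesicSpace X]
    (hc : ¬ IsCocompactAction G X) (x : X) :
    ∃ ρ : ℝ → X, ρ 0 = x ∧ (∀ s t : ℝ, 0 ≤ s → 0 ≤ t → dist (ρ s) (ρ t) = |s - t|) ∧
      ∀ t : ℝ, 0 ≤ t → ∀ g : G, t - 1 ≤ dist (ρ t) (g • x) := by
  have h1 : ∀ n : ℕ, ∃ z : X, (n : ℝ) < dist x z ∧ ∀ g : G, dist x z - 1 ≤ dist z (g • x) := by
    intro n
    obtain ⟨y, hy⟩ : ∃ y : X, ∀ g : G, (n : ℝ) < dist y (g • x) := by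
      by_contra! hcon
      refine hc ⟨Metric.closedBall x n, isCompact_closedBall x n, fun y => ?_⟩
      obtain ⟨g, hg⟩ := hcon y
      refine ⟨g, g⁻¹ • y, ?_, smul_inv_smul g y⟩
      rwa [Metric.mem_closedBall, ← dist_smul g, smul_inv_smul]
    -- The infimum need not be attained; the slack `1` is the one in `t - 1`. Translation makes `x`
    -- an almost nearest orbit point.
    obtain ⟨g, hg⟩ := exists_lt_of_ciInf_lt
      (lt_add_one (⨅ g : G, dist y (g • x)))
    refine ⟨g⁻¹ • y, ?_, fun k => ?_⟩
    · rw [dist_comm, ← dist_smul g, smul_inv_smul]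
      exact hy g
    · have e1 : ⨅ g : G, dist y (g • x) ≤ dist y ((g * k) • x) :=
        ciInf_le ⟨0, by rintro _ ⟨b, rfl⟩; exact dist_nonneg⟩ (g * k)
      rw [← dist_smul g (g⁻¹ • y), ← dist_smul g x, smul_inv_smul, ← mul_smul, dist_comm (g • x)]
      linarith
  choose z hz hz' using h1
  choose γ hγ using fun n => GeodesicSpace.exists_geodesic x (z n)
  replace hγ : ∀ n, IsGeodesicSegment (γ n) x (z n) := hγ
  -- The ray is a pointwise limit along an ultrafilter of geodesics from `x` to `z n`; its values at
  -- negative times are irrelevant.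
  let U : Ultrafilter ℕ := hyperfilter ℕ
  have hU : (U : Filter ℕ) ≤ atTop := Nat.hyperfilter_le_atTop
  have hmem : ∀ t : ℝ, 0 ≤ t → ∀ᶠ n in (U : Filter ℕ), t ∈ Set.Icc 0 (dist x (z n)) := by
    intro t ht
    refine hU ?_
    obtain ⟨N, hN⟩ := exists_nat_ge t
    filter_upwards [eventually_ge_atTop N] with n hn
    have : (N : ℝ) ≤ n := by exact_mod_cast hn
    exact ⟨ht, by linarith [hz n]⟩
  have hlim : ∀ t : ℝ, ∃ a : X, 0 ≤ t → Tendsto (fun n => γ n t) (U : Filter ℕ) (𝓝 a) := by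
    intro t
    by_cases ht : 0 ≤ t
    · obtain ⟨a, -, ha⟩ := isCompact_iff_ultrafilter_le_nhds.1 (isCompact_closedBall x t)
        (U.map fun n => γ n t) (by
          rw [le_principal_iff]
          change ∀ᶠ n in (U : Filter ℕ), γ n t ∈ Metric.closedBall x t
          filter_upwards [hmem t ht] with n hn
          rw [Metric.mem_closedBall, dist_comm, (hγ n).dist_left hn])
      exact ⟨a, fun _ => ha⟩
    · exact ⟨x, fun h => absurd h ht⟩
  choose ρ hρ using hlim
  refine ⟨ρ, ?_, fun s t hs ht => ?_, fun t ht g => ?_⟩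
  · refine tendsto_nhds_unique (hρ 0 le_rfl) ?_
    simp only [(hγ _).1]
    exact tendsto_const_nhds
  · refine tendsto_nhds_unique ((hρ s hs).dist (hρ t ht)) (tendsto_const_nhds.congr' ?_)
    filter_upwards [hmem s hs, hmem t ht] with n h1 h2
    exact ((hγ n).2.2 s h1 t h2).symm
  · refine ge_of_tendsto ((hρ t ht).dist tendsto_const_nhds) ?_
    filter_upwards [hmem t ht] with n h1
    have e1 := (hγ n).dist_right h1
    have e2 := hz' n g
    have e3 := dist_triangle_left (z n) (g • x) (γ n t)
    linarith

theorem tendsto_gp_of_ray {ρ : ℝ → X}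
    (hρ : ∀ s t : ℝ, 0 ≤ s → 0 ≤ t → dist (ρ s) (ρ t) = |s - t|) (x : X) :
    Tendsto (fun n : ℕ × ℕ => gp x (ρ n.1) (ρ n.2)) atTop atTop := by
  refine tendsto_gp_base (x := ρ 0) (tendsto_atTop.2 fun r => ?_) x
  obtain ⟨N, hN⟩ := exists_nat_ge r
  filter_upwards [eventually_ge_atTop (N, N)] with n hn
  have h1 : (N : ℝ) ≤ n.1 := by exact_mod_cast hn.1
  have h2 : (N : ℝ) ≤ n.2 := by exact_mod_cast hn.2
  have h0 : (0 : ℝ) ≤ N := Nat.cast_nonneg N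
  rw [gp_def, hρ _ _ le_rfl (Nat.cast_nonneg _), hρ _ _ le_rfl (Nat.cast_nonneg _),
    hρ _ _ (Nat.cast_nonneg _) (Nat.cast_nonneg _), zero_sub, zero_sub, abs_neg, abs_neg,
    abs_of_nonneg (Nat.cast_nonneg _), abs_of_nonneg (Nat.cast_nonneg _)]
  rcases abs_cases ((n.1 : ℝ) - n.2) with ⟨e, -⟩ | ⟨e, -⟩ <;> rw [e] <;> linarith

/-- Geometrically finite actions are cocompact or of general type. -/
theorem IsGeometricallyFinite.isCocompactAction_or_isGeneralType [Nonempty X] [ProperSpace X]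
    [GeodesicSpace X] [HyperbolicSpace X] (hgf : IsGeometricallyFinite G X) :
    IsCocompactAction G X ∨ IsGeneralType G X := by
  by_contra! hcon
  obtain ⟨hc, hgt⟩ := hcon
  obtain ⟨x⟩ := ‹Nonempty X›
  obtain ⟨δ, h⟩ := exists_fourPoint X
  obtain ⟨ρ, h0, hρ, hfar⟩ := exists_ray_of_not_isCocompactAction hc x
  let u : CauchyGromovSeq X := ⟨fun n => ρ n, tendsto_gp_of_ray hρ⟩
  have hp : ConvergesTo u.1 (Boundary.mk u) := ⟨u, rfl, rfl⟩
  have hr : ¬ IsRadial G x u.1 := h.not_isRadial_of_ray h0 hρ hfar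
  have hpar : ∀ (p : ℕ → X) (ξ : Boundary X), ConvergesTo p ξ → ¬ IsRadial G x p →
      IsBoundedParabolic G ξ ∧ ¬ IsOpen {ξ} := fun p ξ hp hr =>
    (hgf ξ).resolve_left fun hcon => hr (hcon.isRadial hp x)
  obtain ⟨hbp, hiso⟩ := hpar _ _ hp hr
  by_cases hex : ∃ g : G, IsHyperbolicElement X g
  · obtain ⟨g, hg⟩ := hex
    obtain ⟨B, hB⟩ := exists_dist_le_of_not_isGeneralType hg hgt hp hr
    exact hiso (hbp.isOpen hB)
  · push Not at hex
    obtain ⟨η, B, hB⟩ := exists_dist_le_of_forall_not_isHyperbolicElement hex hp hiso x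
    obtain ⟨q, hq⟩ := exists_convergesTo η
    obtain ⟨hbp', hiso'⟩ := hpar q η hq
      (h.not_isRadial_of_forall_not_isHyperbolicElement hex x q)
    exact hiso' (hbp'.isOpen hB)

end Main

/-! ### Properness of the isometry group -/

section Isom

variable {X : Type*} [MetricSpace X]

/-- By `continuous_isom_of_apply` the topology of pointwise convergence is at least as fine as the
compact-open one. -/
theorem le_nhds_isom_of_apply {l : Filter (X ≃ᵢ X)} {e : X ≃ᵢ X}
    (h : ∀ x, Tendsto (fun g : X ≃ᵢ X => g x) l (𝓝 (e x))) : l ≤ 𝓝 e := by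
  let τ : TopologicalSpace (X ≃ᵢ X) :=
    ⨅ x : X, TopologicalSpace.induced (fun g : X ≃ᵢ X => g x) inferInstance
  have hτ : τ ≤ isomTopology := continuous_id_iff_le.1
    (@continuous_isom_of_apply X _ (X ≃ᵢ X) τ id fun x =>
      continuous_iInf_dom (i := x) continuous_induced_dom)
  refine le_trans ?_ (nhds_mono hτ)
  rw [nhds_iInf]
  refine le_iInf fun x => ?_
  rw [nhds_induced]
  exact tendsto_iff_comap.1 (h x)

/-- The isometry group of a proper space acts properly. -/
theorem isCompact_setOf_dist_isom_le [ProperSpace X] (x : X) (r : ℝ) :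
    IsCompact {g : X ≃ᵢ X | dist x (g x) ≤ r} := by
  refine isCompact_iff_ultrafilter_le_nhds.2 fun U hU => ?_
  have hU' : ∀ᶠ g in (U : Filter (X ≃ᵢ X)), dist x (g x) ≤ r := le_principal_iff.1 hU
  have hlim : ∀ φ : (X ≃ᵢ X) → X ≃ᵢ X, (∀ g, dist x (φ g x) = dist x (g x)) →
      ∀ y : X, ∃ a : X, Tendsto (fun g => φ g y) (U : Filter (X ≃ᵢ X)) (𝓝 a) := by
    intro φ hφ y
    obtain ⟨a, -, ha⟩ := isCompact_iff_ultrafilter_le_nhds.1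
      (isCompact_closedBall x (r + dist x y)) (U.map fun g => φ g y) (by
        rw [le_principal_iff]
        change ∀ᶠ g in (U : Filter (X ≃ᵢ X)), φ g y ∈ Metric.closedBall x (r + dist x y)
        filter_upwards [hU'] with g hg
        rw [Metric.mem_closedBall, dist_comm]
        have := dist_triangle x (φ g x) (φ g y)
        rw [(φ g).dist_eq, hφ] at this
        linarith)
    exact ⟨a, ha⟩
  choose F hF using hlim (fun g => g) fun _ => rfl
  -- The limit of the inverses is needed for surjectivity of `F`.
  choose F' hF' using hlim (fun g => g⁻¹) fun g => dist_inv_smul_self g x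
  have hiso : Isometry F := Isometry.of_dist_eq fun y z =>
    tendsto_nhds_unique ((hF y).dist (hF z)) (by
      simp only [IsometryEquiv.dist_eq]
      exact tendsto_const_nhds)
  have hFF' : ∀ y, F (F' y) = y := by
    intro y
    refine tendsto_nhds_unique (hF (F' y)) (tendsto_iff_dist_tendsto_zero.2 ?_)
    have h1 := tendsto_iff_dist_tendsto_zero.1 (hF' y)
    refine h1.congr fun g => ?_
    rw [← g.dist_eq, IsometryEquiv.apply_inv_self, dist_comm]
  let e : X ≃ᵢ X := IsometryEquiv.mk' F F' hFF' hiso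
  refine ⟨e, ?_, le_nhds_isom_of_apply hF⟩
  exact le_of_tendsto (tendsto_const_nhds.dist (hF x)) hU'

theorem isMetricallyProper_of_isClosed [ProperSpace X] {G : Subgroup (X ≃ᵢ X)}
    (hG : IsClosed (G : Set (X ≃ᵢ X))) : IsMetricallyProper G X := fun x r =>
  hG.isClosedEmbedding_subtypeVal.isCompact_preimage (isCompact_setOf_dist_isom_le x r)

end Isom

end HypGrp

open HypGrp
theorem theoremF :
    (∀ (G : Type u) [Group G] [TopologicalSpace G] [IsTopologicalGroup G] [LocallyCompactSpace G],
      IsAmenable G → IsRelativelyHyperbolic.{u, v} G → IsHyperbolicGroup G) ∧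
    (∀ (X : Type w) [MetricSpace X] [Nonempty X] [ProperSpace X] [GeodesicSpace X]
      [HyperbolicSpace X] (G : Subgroup (X ≃ᵢ X)),
      IsClosed (G : Set (X ≃ᵢ X)) → IsGeometricallyFinite G X →
        (IsCocompactAction G X ∨ IsGeneralType G X) ∧
        (IsCocompactAction G X → IsHyperbolicGroup G) ∧
        (IsGeneralType G X → ¬ IsAmenable G)) := by
  constructor
  · rintro G _ _ _ _ ha ⟨X, _, _, _, _, _, _, _, hcont, hproper, hgf⟩
    rcases hgf.isCocompactAction_or_isGeneralType with h | h
    · exact isHyperbolicGroup_of_cocompact hproper h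
    · exact absurd ha (not_isAmenable_of_isGeneralType
        (fun x => continuous_id.smul continuous_const) h)
  · intro X _ _ _ _ _ G hG hgf
    exact ⟨hgf.isCocompactAction_or_isGeneralType,
      isHyperbolicGroup_of_cocompact (isMetricallyProper_of_isClosed hG),
      not_isAmenable_of_isGeneralType fun x =>
        (continuous_isom_apply x).comp continuous_subtype_val⟩
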